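/- **Setting.** Let $\mathbb T^2=\mathbb R^2/\mathbb Z^2$ with Lebesgue measure of total mass $1$, and $\hat f(k)=\int_{\mathbb T^2}e^{-2\pi i k\cdot x}f(x)\,dx$ for $k\in\mathbb Z^2$. For $s\in\mathbb R$ put $\|f\|_{\dot H^s}=\big(\sum_{k\neq 0}|k|^{2s}|\hat f(k)|^2\big)^{1/2}$, where for matrix fields $|\hat f(k)|$ is the Frobenius norm, and $\mathbb P_{\neq 0}f=f-\int_{\mathbb T^2} f$. Pointwise values of vectors and matrices are measured in the Euclidean and Frobenius norm. Let $\varphi:\mathbb R^2\to[0,1]$ be any smooth radial function supported in $\{6/7\le|\xi|\le 2\}$, equal to $1$ on $\{1\le|\xi|\le 12/7\}$, with $\sum_{j\ge 0}\varphi(2^{-j}\xi)=1$ for $|\xi|\ge 1$ and such that, for $\varphi_j=\varphi(2^{-j}\cdot)$, $\operatorname{supp}\varphi_j\cap\operatorname{supp}\varphi_{j'}=\emptyset$ when $|j-j'|\ge 2$. Put $\mathbb P_{2^j}f(x)=\sum_{k\in\mathbb Z^2}\varphi_j(k)\hat f(k)e^{2\pi i k\cdot x}$ for $j\geq 0$.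 For $q\ge 0$ let $p(q)=2-2^{-q-10}$. For vector fields $u_0,u_1,\dots$ on $\mathbb T^2$ put $u_{-1}=0$ and $w_{q'}=u_{q'}-u_{q'-1}$ for $q'\ge 0$. **Inductive conditions.** Let $C>0$ and $q\ge 0$. Vector fields $u_0,\dots,u_q:\mathbb T^2\to\mathbb R^2$ and a matrix field $R_q:\mathbb T^2\to\mathbb R^{2\times 2}$ satisfy the inductive conditions at level $q$ with constant $C$ if the following hold. 1. $R_q$ is symmetric and, for some smooth $p_q:\mathbb T^2\to\mathbb R$, $$\operatorname{div}(u_q\otimes u_q)-\Delta u_q+\nabla p_q=\operatorname{div}R_q,\qquad \operatorname{div}u_q=0 .$$ 2. $u_q$ is $C^\infty$ with $\int_{\mathbb T^2}u_q=0$, and $\|u_q\|_{L^{p(q)}}>C^{-1}(1+2^{-q})$. For all $0\le q'\le q$, $w_{q'}$ is $C^\infty$ and $\|w_{q'}\|_{L^{p(q')}}<2^{-q'-2}$. 3. $R_q$ is $C^\infty$ and $\|R_q\|_{\dot H^{-2}}<2^{-q-10}$. 4. There are $j_0,\dots,j_q\ge 0$ with $\mathbb P_{2^{j_{q'}}}w_{q'}=w_{q'}$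 for all $q'\le q$, and $\operatorname{supp}\varphi_{j_{q'}}\cap\operatorname{supp}\varphi_{j_{q''}}=\emptyset$ for all $q'<q''\le q$ (the increments lie in disjoint Littlewood–Paley shells). 5. $$\sum_{\substack{0\le m,n\le q\\ m\ne n}}\|w_m\otimes w_n\|_{L^1}<C-2^{-q}\qquad\text{and}\qquad \sum_{0\le m\le q}\|\mathbb P_{\ne 0}(w_m\otimes w_m)\|_{\dot H^{-2}}<C-2^{-q}.$$ **Proposition.** Fix $C>0$ and $q\ge 0$, and suppose that $u_0,\dots,u_q$ and $R_q$ satisfy the inductive conditions at level $q$ with constant $C$. Then there are a vector field $w_{q+1}$ and a matrix field $R_{q+1}$ on $\mathbb T^2$, both $C^\infty$ and of mean zero, such that, with $u_{q+1}=u_q+w_{q+1}$, the fields $u_0,\dots,u_{q+1}$ and $R_{q+1}$ satisfy the inductive conditions at level $q+1$ with the same constant $C$. -/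

import Mathlib

open MeasureTheory
open scoped ContDiff ENNReal

noncomputable section

namespace StationaryNS

/-- The torus `𝕋² = ℝ² / ℤ²`. -/
abbrev T2 : Type := UnitAddTorus (Fin 2)

/-- The plane, with the Euclidean norm. -/
abbrev E2 : Type := EuclideanSpace ℝ (Fin 2)

/-- Normalised Lebesgue measure on `𝕋²`, of total mass one. It is the measure with respect to which
`UnitAddTorus.mFourierCoeff` is defined. -/
abbrev μT : Measure T2 := Measure.pi fun _ : Fin 2 => (AddCircle.haarAddCircle : Measure UnitAddCircle)

/-- Vector fields on the torus. -/
abbrev VField : Type := T2 → E2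

/-- Fields of `2 × 2` matrices on the torus. -/
abbrev MField : Type := T2 → Matrix (Fin 2) (Fin 2) ℝ

/-! ### Calculus on the torus -/

/-- `f` is `C^∞` on the torus: its `ℤ²`-periodic lift to the plane is `C^∞`. -/
def Smooth (f : T2 → ℝ) : Prop :=
  ContDiff ℝ ∞ fun y : Fin 2 → ℝ => f fun i => (y i : UnitAddCircle)

/-- A vector field is `C^∞` if its components are. -/
def SmoothV (u : VField) : Prop := ∀ i, Smooth fun x => u x i

/-- A matrix field is `C^∞` if its entries are. -/
def SmoothM (R : MField) : Prop := ∀ i j, Smooth fun x => R x i j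

/-- The partial derivative `∂ᵢ f` on the torus. -/
def pd (i : Fin 2) (f : T2 → ℝ) : T2 → ℝ := fun x =>
  deriv (fun t : ℝ => f (x + Pi.single i (t : UnitAddCircle))) 0

/-- A vector field has zero mean. -/
def MeanZeroV (u : VField) : Prop := ∀ i, ∫ x, u x i ∂μT = 0

/-- A matrix field has zero mean. -/
def MeanZeroM (R : MField) : Prop := ∀ i j, ∫ x, R x i j ∂μT = 0

/-- The tensor product `u ⊗ v`, with entries `uᵢ vⱼ`. -/
def outer (u v : VField) : MField := fun x => Matrix.of fun i j => u x i * v x j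

/-- The projection `ℙ_{≠0}` that removes the mean, applied to each entry. -/
def removeMean (R : MField) : MField := fun x =>
  Matrix.of fun i j => R x i j - ∫ y, R y i j ∂μT

/-- `(u, R)` with `R` symmetric solves the stationary Navier-Stokes-Reynolds system
`div (u ⊗ u) - Δ u + ∇ p = div R`, `div u = 0`, for some smooth pressure `p` on the torus. -/
def SolvesNSR (u : VField) (R : MField) : Prop :=
  (∀ x, (R x).IsSymm) ∧
  (∃ p : T2 → ℝ, Smooth p ∧ ∀ x i,
    (∑ j, pd j (fun y => outer u u y i j) x) - (∑ j, pd j (pd j fun y => u y i) x) + pd i p x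
      = ∑ j, pd j (fun y => R y i j) x) ∧
  ∀ x, ∑ i, pd i (fun y => u y i) x = 0

/-! ### Littlewood-Paley projections -/

/-- The lattice frequency `k ∈ ℤ²` as a point of the plane. -/
def freq (k : Fin 2 → ℤ) : E2 := WithLp.toLp 2 fun i => (k i : ℝ)

/-- The rescaled bump `φⱼ = φ(2⁻ʲ ·)`. -/
def dil (φ : E2 → ℝ) (j : ℕ) : E2 → ℝ := fun ξ => φ (((2 : ℝ) ^ j)⁻¹ • ξ)

/-- The radial bump functions that generate the Littlewood-Paley decomposition. -/
structure IsLPBump (φ : E2 → ℝ) : Prop where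
  smooth : ContDiff ℝ ∞ φ
  mem_Icc : ∀ ξ, φ ξ ∈ Set.Icc (0 : ℝ) 1
  radial : ∀ ξ η, ‖ξ‖ = ‖η‖ → φ ξ = φ η
  supp : tsupport φ ⊆ {ξ | 6 / 7 ≤ ‖ξ‖ ∧ ‖ξ‖ ≤ 2}
  eq_one : ∀ ξ, 1 ≤ ‖ξ‖ → ‖ξ‖ ≤ 12 / 7 → φ ξ = 1
  hasSum : ∀ ξ, 1 ≤ ‖ξ‖ → HasSum (fun j : ℕ => dil φ j ξ) 1
  disjoint : ∀ j j' : ℕ, j + 2 ≤ j' → Disjoint (tsupport (dil φ j)) (tsupport (dil φ j'))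

/-- The Fourier coefficient `f̂(k) = ∫ e^{-2πi k·x} f(x) dx`. -/
def coeff (f : T2 → ℝ) (k : Fin 2 → ℤ) : ℂ :=
  UnitAddTorus.mFourierCoeff (fun x => (f x : ℂ)) k

/-- The projection `ℙ_{2ʲ} f = ∑ₖ φⱼ(k) f̂(k) e^{2πi k·x}` (only finitely many terms are nonzero). -/
def shellProj (φ : E2 → ℝ) (j : ℕ) (f : T2 → ℝ) : T2 → ℂ := fun x =>
  ∑' k : Fin 2 → ℤ, (dil φ j (freq k) : ℂ) * coeff f k * UnitAddTorus.mFourier k x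

/-- `ℙ_{2ʲ} w = w`, for a vector field `w`. -/
def FixedByShell (φ : E2 → ℝ) (j : ℕ) (w : VField) : Prop :=
  ∀ x i, shellProj φ j (fun y => w y i) x = (w x i : ℂ)

/-! ### Norms, with values in `[0, ∞]` -/

/-- The `Lᵖ` norm of a vector field, with the Euclidean norm on values. -/
def LpNorm (p : ℝ) (u : VField) : ℝ≥0∞ := eLpNorm u (ENNReal.ofReal p) μT

/-- The `L¹` norm of a matrix field, with the Frobenius norm on values. -/
def L1NormM (R : MField) : ℝ≥0∞ :=
  ∫⁻ x, ENNReal.ofReal (Real.sqrt (∑ i, ∑ j, R x i j ^ 2)) ∂μT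

/-- The homogeneous Sobolev norm `‖R‖_{Ḣˢ} = (∑_{k ≠ 0} |k|^{2s} |R̂(k)|²)^{1/2}` of a matrix
field. -/
def HNormM (s : ℝ) (R : MField) : ℝ≥0∞ :=
  (∑' k : Fin 2 → ℤ, if k = 0 then 0 else
    ENNReal.ofReal (‖freq k‖ ^ (2 * s) * ∑ i, ∑ j, ‖coeff (fun x => R x i j) k‖ ^ 2)) ^ (1 / 2 : ℝ)

/-! ### The inductive conditions -/

/-- The increment `u_q - u_{q-1}`, with the convention `u_{-1} = 0`. -/
def incr (u : ℕ → VField) : ℕ → VField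
  | 0 => u 0
  | q + 1 => u (q + 1) - u q

/-- The exponent `p(q) = 2 - 2^{-q-10}`. -/
def pexp (q : ℕ) : ℝ := 2 - (2 : ℝ) ^ (-(q : ℤ) - 10)

/-- The inductive conditions at level `q`, with constant `C`, on the velocities `u₀, …, u_q` and the
stress `R = R_q`. In the last two conditions the increment `u_{m+1} - u_m`, for `-1 ≤ m ≤ q - 1`,
is `incr u (m + 1)`. -/
structure InductiveConditions (φ : E2 → ℝ) (C : ℝ) (q : ℕ) (u : ℕ → VField) (R : MField) :
    Prop where
  solves : SolvesNSR (u q) R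
  mean_zero : MeanZeroV (u q)
  smooth : SmoothV (u q)
  lower_bound : ENNReal.ofReal (C⁻¹ * (1 + (2 : ℝ) ^ (-(q : ℤ)))) < LpNorm (pexp q) (u q)
  incr_bound : ∀ q' ≤ q, LpNorm (pexp q') (incr u q') < ENNReal.ofReal ((2 : ℝ) ^ (-(q' : ℤ) - 2))
  incr_smooth : ∀ q' ≤ q, SmoothV (incr u q')
  stress_smooth : SmoothM R
  stress_bound : HNormM (-2) R < ENNReal.ofReal ((2 : ℝ) ^ (-(q : ℤ) - 10))
  shells : ∃ j : ℕ → ℕ, (∀ q' ≤ q, FixedByShell φ (j q') (incr u q')) ∧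
    ∀ q' q'', q' < q'' → q'' ≤ q →
      Disjoint (tsupport (dil φ (j q'))) (tsupport (dil φ (j q'')))
  off_diagonal : ∑ mn ∈ (Finset.range (q + 1)).offDiag, L1NormM (outer (incr u mn.1) (incr u mn.2))
    < ENNReal.ofReal (C - (2 : ℝ) ^ (-(q : ℤ)))
  diagonal : ∑ m ∈ Finset.range (q + 1), HNormM (-2) (removeMean (outer (incr u m) (incr u m)))
    < ENNReal.ofReal (C - (2 : ℝ) ^ (-(q : ℤ)))

end StationaryNS

end

/-!
The increment `w` is an explicit trigonometric velocity field whose self-interaction `w ⊗ w` cancels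
`R_q` in the topology of `Ḣ^{-2}`, up to a constant multiple of the identity. With
`R_{q+1}` the mean-free part of `R_q + w ⊗ w + u_q ⊗ w + w ⊗ u_q - ∇w - (∇w)ᵀ`, the system at level
`q + 1` holds with the same pressure (`SolvesNSR.add_increment`).

The norm of `Ḣ^{-2}` is so weak in two dimensions that a matrix field with bounded Fourier
coefficients is small as soon as finitely many of its coefficients are small
(`exists_hsq_le`). Hence everything follows from a field `w` that is bounded in `L²`, arbitrarily
small in `L¹`, supported in one high Littlewood-Paley shell, and such that finitely many Fourier
coefficients of `w ⊗ w` are close to those of `-R_q` (`exists_increment`). Smallness in `L^{p(q+1)}`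
follows by interpolation, as `p(q+1) < 2` (`exists_LpNorm_lt`); the interactions with the earlier,
bounded increments are small in `L¹`; and the linear term is controlled since `w` lives in one shell
(`hsq_symmGrad_le`).

To construct `w = ∇^⊥ψ`, write the matrix to be attained, plus a large multiple of the identity, as
a combination with nonnegative coefficients `g l / 2` of the four matrices `v ⊗ v`, where `v` is one
of `(1,0)`, `(0,1)`, `(1,1)`, `(1,-1)`. Each `g l` is replaced by the square of a trigonometric
polynomial `A l`, the product of an approximation of `√(g l)` and of a lacunary Riesz product: the
latter makes `A l` small in `L¹` without changing the low modes of its square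
(`exists_intermittent_sqrt`). Then `ψ` is the sum of the `A l sin (2πN v·x) / (2πN)`. For large `N`
all cross terms are of high frequency, so that the low modes of the products `∂ₐψ ∂_bψ` are those
of the sum of the `(A l)² v ⊗ v / 2` up to `O(1/N)` (`eventually_coeff_pd_stream`). Since
the lengths of the four vectors have ratio at most `√2 < 12/7`, a suitable `N` puts all frequencies
of `ψ` where the shell projection is the identity (`eventually_stream_inShell`). As `ψ` is a
trigonometric polynomial, the localisation in frequency and the vanishing of the divergence are
exact.
-/

noncomputable section

namespace StationaryNS

open UnitAddTorus Finset

theorem integrable_of_continuous {E : Type*} [NormedAddCommGroup E] {f : T2 → E}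
    (hf : Continuous f) : Integrable f μT :=
  hf.integrable_of_hasCompactSupport (HasCompactSupport.of_compactSpace f)

theorem exists_bound_of_continuous {f : T2 → ℝ} (hf : Continuous f) : ∃ M : ℝ, ∀ x, |f x| ≤ M := by
  obtain ⟨M, hM⟩ := isCompact_univ.exists_bound_of_continuousOn hf.continuousOn
  exact ⟨M, fun x => hM x (Set.mem_univ x)⟩

/-! ### Fourier coefficients -/

theorem coeff_def (f : T2 → ℝ) (k : Fin 2 → ℤ) :
    coeff f k = ∫ x, mFourier (-k) x * (f x : ℂ) ∂μT := rfl

theorem norm_mFourier_apply (k : Fin 2 → ℤ) (x : T2) : ‖mFourier k x‖ = 1 := by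
  simp only [mFourier, ContinuousMap.coe_mk, norm_prod, fourier_apply, Circle.norm_coe,
    prod_const_one]

theorem integral_mFourier (k : Fin 2 → ℤ) :
    ∫ x, mFourier k x ∂μT = if k = 0 then 1 else 0 := by
  have h := orthonormal_iff_ite.mp (orthonormal_mFourier (d := Fin 2)) 0 k
  rw [ContinuousMap.inner_toLp] at h
  simp only [mFourier_zero] at h
  have h2 : ∫ x, mFourier k x ∂μT = if 0 = k then 1 else 0 := by
    rw [← h]
    refine integral_congr_ae (Filter.Eventually.of_forall fun x => ?_)
    simp
  rw [h2]
  simp [eq_comm]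

theorem integrable_coeff {f : T2 → ℝ} (hf : Continuous f) (k : Fin 2 → ℤ) :
    Integrable (fun x => mFourier k x * (f x : ℂ)) μT :=
  integrable_of_continuous (by fun_prop)

theorem coeff_add {f g : T2 → ℝ} (hf : Continuous f) (hg : Continuous g) (k : Fin 2 → ℤ) :
    coeff (fun x => f x + g x) k = coeff f k + coeff g k := by
  simp only [coeff_def]
  rw [← integral_add (integrable_coeff hf _) (integrable_coeff hg _)]
  congr 1; ext x; push_cast; ring

theorem coeff_sub {f g : T2 → ℝ} (hf : Continuous f) (hg : Continuous g) (k : Fin 2 → ℤ) :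
    coeff (fun x => f x - g x) k = coeff f k - coeff g k := by
  simp only [coeff_def]
  rw [← integral_sub (integrable_coeff hf _) (integrable_coeff hg _)]
  congr 1; ext x; push_cast; ring

theorem coeff_const_mul (c : ℝ) (f : T2 → ℝ) (k : Fin 2 → ℤ) :
    coeff (fun x => c * f x) k = c * coeff f k := by
  simp only [coeff_def]
  rw [← integral_const_mul]
  congr 1; ext x; push_cast; ring

theorem coeff_neg (f : T2 → ℝ) (k : Fin 2 → ℤ) :
    coeff (fun x => -f x) k = -coeff f k := by
  simpa using coeff_const_mul (-1) f k

theorem coeff_sum {ι : Type*} (s : Finset ι) {f : ι → T2 → ℝ} (hf : ∀ i ∈ s, Continuous (f i))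
    (k : Fin 2 → ℤ) : coeff (fun x => ∑ i ∈ s, f i x) k = ∑ i ∈ s, coeff (f i) k := by
  simp only [coeff_def]
  rw [← integral_finsetSum _ fun i hi => integrable_coeff (hf i hi) _]
  congr 1; ext x; push_cast; rw [mul_sum]

theorem coeff_const (c : ℝ) {k : Fin 2 → ℤ} (hk : k ≠ 0) : coeff (fun _ => c) k = 0 := by
  rw [coeff_def, integral_mul_const, integral_mFourier, if_neg (by simpa using hk), zero_mul]

theorem coeff_zero (f : T2 → ℝ) : coeff f 0 = ((∫ x, f x ∂μT : ℝ) : ℂ) := by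
  rw [coeff_def, ← integral_complex_ofReal]
  congr 1; ext x; simp [mFourier_zero]

theorem norm_coeff_le (f : T2 → ℝ) (k : Fin 2 → ℤ) : ‖coeff f k‖ ≤ ∫ x, |f x| ∂μT := by
  rw [coeff_def]
  refine (norm_integral_le_integral_norm _).trans (le_of_eq ?_)
  congr 1; ext x
  rw [norm_mul, norm_mFourier_apply, one_mul, Complex.norm_real, Real.norm_eq_abs]

theorem norm_coeff_le_of_bound {f : T2 → ℝ} {M : ℝ} (hf : ∀ x, |f x| ≤ M) (k : Fin 2 → ℤ) :
    ‖coeff f k‖ ≤ M := by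
  refine (norm_coeff_le f k).trans ?_
  have h0 : 0 ≤ M := (abs_nonneg _).trans (hf 0)
  have := integral_mono_of_nonneg (μ := μT) (f := fun x => |f x|) (g := fun _ => M)
    (Filter.Eventually.of_forall fun x => abs_nonneg _) (integrable_const _)
    (Filter.Eventually.of_forall hf)
  simpa using this

/-! ### Real trigonometric polynomials -/

/-- `f` is a real trigonometric polynomial: a finite complex combination of characters that takes
real values. -/
def IsTrig (f : T2 → ℝ) : Prop :=
  ∃ g ∈ mFourierSubalgebra (Fin 2), ∀ x, g x = (f x : ℂ)

theorem mFourier_mem (k : Fin 2 → ℤ) : mFourier k ∈ mFourierSubalgebra (Fin 2) :=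
  Algebra.subset_adjoin ⟨k, rfl⟩

namespace IsTrig
variable {f g : T2 → ℝ}

theorem continuous (hf : IsTrig f) : Continuous f := by
  obtain ⟨F, -, h⟩ := hf
  have : f = fun x => (F x).re := by ext x; rw [h]; simp
  rw [this]; fun_prop

theorem add (hf : IsTrig f) (hg : IsTrig g) : IsTrig (fun x => f x + g x) := by
  obtain ⟨F, hF, h⟩ := hf
  obtain ⟨G, hG, h'⟩ := hg
  exact ⟨F + G, add_mem hF hG, fun x => by simp [h, h']⟩

theorem mul (hf : IsTrig f) (hg : IsTrig g) : IsTrig (fun x => f x * g x) := by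
  obtain ⟨F, hF, h⟩ := hf
  obtain ⟨G, hG, h'⟩ := hg
  exact ⟨F * G, mul_mem hF hG, fun x => by simp [h, h']⟩

theorem const (c : ℝ) : IsTrig (fun _ => c) :=
  ⟨algebraMap ℂ _ (c : ℂ), algebraMap_mem _ _, fun x => by simp⟩

theorem const_mul (c : ℝ) (hf : IsTrig f) : IsTrig (fun x => c * f x) := (const c).mul hf

theorem neg (hf : IsTrig f) : IsTrig (fun x => -f x) := by simpa using hf.const_mul (-1)

theorem sum {ι : Type*} (s : Finset ι) {f : ι → T2 → ℝ} (hf : ∀ i ∈ s, IsTrig (f i)) :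
    IsTrig (fun x => ∑ i ∈ s, f i x) := by
  classical
  induction s using Finset.induction_on with
  | empty => simpa using const 0
  | insert a s ha ih =>
    simp only [sum_insert ha]
    exact (hf a (mem_insert_self _ _)).add (ih fun i hi => hf i (mem_insert_of_mem hi))

end IsTrig

theorem coeff_of_sum {f : T2 → ℝ} (s : Finset (Fin 2 → ℤ)) (c : (Fin 2 → ℤ) → ℂ)
    (h : ∀ x, (f x : ℂ) = ∑ k ∈ s, c k * mFourier k x) (k : Fin 2 → ℤ) :
    coeff f k = if k ∈ s then c k else 0 := by
  classical
  have : coeff f k = ∑ l ∈ s, c l * ∫ x, mFourier (-k + l) x ∂μT := by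
    rw [coeff_def]
    simp only [h, mul_sum]
    rw [integral_finsetSum _ fun i _ => integrable_of_continuous (by fun_prop)]
    refine sum_congr rfl fun l _ => ?_
    rw [← integral_const_mul]
    congr 1; ext x; rw [mFourier_add]; ring
  rw [this]
  simp only [integral_mFourier, mul_ite, mul_one, mul_zero, neg_add_eq_zero]
  rw [sum_ite_eq]

theorem isTrig_of_sum {f : T2 → ℝ} (s : Finset (Fin 2 → ℤ)) (c : (Fin 2 → ℤ) → ℂ)
    (h : ∀ x, (f x : ℂ) = ∑ k ∈ s, c k * mFourier k x) : IsTrig f := by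
  refine ⟨∑ k ∈ s, c k • mFourier k,
    sum_mem fun k _ => SMulMemClass.smul_mem _ (mFourier_mem k), fun x => ?_⟩
  rw [h]
  simp [ContinuousMap.sum_apply]

/-- Finite Fourier inversion. -/
theorem IsTrig.eq_sum {f : T2 → ℝ} (hf : IsTrig f) : ∃ s : Finset (Fin 2 → ℤ),
    (∀ k ∉ s, coeff f k = 0) ∧ ∀ x, (f x : ℂ) = ∑ k ∈ s, coeff f k * mFourier k x := by
  obtain ⟨F, hF, h⟩ := hf
  have hF' : F ∈ Submodule.span ℂ (Set.range (mFourier (d := Fin 2))) := by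
    rw [← mFourierSubalgebra_coe]; exact hF
  obtain ⟨c, hc⟩ := (Finsupp.mem_span_range_iff_exists_finsupp).mp hF'
  have h2 : ∀ x, (f x : ℂ) = ∑ k ∈ c.support, c k * mFourier k x := by
    intro x
    rw [← h, ← hc, Finsupp.sum]
    simp [ContinuousMap.sum_apply]
  have h3 := coeff_of_sum _ _ h2
  refine ⟨c.support, fun k hk => by rw [h3, if_neg hk], fun x => ?_⟩
  rw [h2]
  exact sum_congr rfl fun k hk => by rw [h3, if_pos hk]

theorem IsTrig.ext {f g : T2 → ℝ} (hf : IsTrig f) (hg : IsTrig g)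
    (h : ∀ k, coeff f k = coeff g k) (x : T2) : f x = g x := by
  obtain ⟨s, hs, hs'⟩ := (hf.add hg.neg).eq_sum
  have h0 : ((f x + -g x : ℝ) : ℂ) = 0 := by
    rw [hs' x]
    refine sum_eq_zero fun k _ => ?_
    rw [coeff_add hf.continuous hg.neg.continuous, coeff_neg, h, add_neg_cancel, zero_mul]
  have : f x + -g x = 0 := by exact_mod_cast h0
  linarith

theorem IsTrig.shellProj_eq {f : T2 → ℝ} (hf : IsTrig f) {φ : E2 → ℝ} {j : ℕ}
    (h : ∀ k, coeff f k ≠ 0 → dil φ j (freq k) = 1) (x : T2) : shellProj φ j f x = f x := by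
  obtain ⟨s, hs, hs'⟩ := hf.eq_sum
  rw [shellProj, tsum_eq_sum (s := s) fun k hk => by rw [hs k hk]; ring, hs']
  refine sum_congr rfl fun k _ => ?_
  by_cases hk : coeff f k = 0
  · simp [hk]
  · rw [h k hk]; simp

/-- The function `cos (2π m · x)`. -/
def cosT (m : Fin 2 → ℤ) (x : T2) : ℝ := (mFourier m x).re

/-- The function `sin (2π m · x)`. -/
def sinT (m : Fin 2 → ℤ) (x : T2) : ℝ := (mFourier m x).im

theorem cosT_eq (m : Fin 2 → ℤ) (x : T2) :
    (cosT m x : ℂ) = (mFourier m x + mFourier (-m) x) / 2 := by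
  rw [mFourier_neg, Complex.add_conj, cosT]; push_cast; ring

theorem sinT_eq (m : Fin 2 → ℤ) (x : T2) :
    (sinT m x : ℂ) = (mFourier m x - mFourier (-m) x) / 2 * (-Complex.I) := by
  rw [mFourier_neg, Complex.sub_conj, sinT]; push_cast
  linear_combination (((mFourier m) x).im : ℂ) * Complex.I_mul_I

theorem isTrig_cosT (m : Fin 2 → ℤ) : IsTrig (cosT m) := by
  refine ⟨(1 / 2 : ℂ) • (mFourier m + mFourier (-m)),
    SMulMemClass.smul_mem _ (add_mem (mFourier_mem _) (mFourier_mem _)), fun x => ?_⟩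
  rw [cosT_eq]; simp; ring

theorem isTrig_sinT (m : Fin 2 → ℤ) : IsTrig (sinT m) := by
  refine ⟨(-Complex.I / 2 : ℂ) • (mFourier m - mFourier (-m)),
    SMulMemClass.smul_mem _ (sub_mem (mFourier_mem _) (mFourier_mem _)), fun x => ?_⟩
  rw [sinT_eq]; simp; ring

theorem abs_cosT_le (m : Fin 2 → ℤ) (x : T2) : |cosT m x| ≤ 1 :=
  (Complex.abs_re_le_norm _).trans (norm_mFourier_apply m x).le

theorem abs_sinT_le (m : Fin 2 → ℤ) (x : T2) : |sinT m x| ≤ 1 :=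
  (Complex.abs_im_le_norm _).trans (norm_mFourier_apply m x).le

theorem cosT_zero (x : T2) : cosT 0 x = 1 := by simp [cosT, mFourier_zero]

theorem cosT_mul_cosT (m n : Fin 2 → ℤ) (x : T2) :
    cosT m x * cosT n x = (cosT (m + n) x + cosT (m - n) x) / 2 := by
  simp only [cosT, sub_eq_add_neg, mFourier_add, mFourier_neg, Complex.mul_re, Complex.conj_re,
    Complex.conj_im]
  ring

theorem coeff_mul_cosT {f : T2 → ℝ} (hf : Continuous f) (m k : Fin 2 → ℤ) :
    coeff (fun x => f x * cosT m x) k = (coeff f (k - m) + coeff f (k + m)) / 2 := by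
  simp only [coeff_def]
  rw [← integral_add (integrable_coeff hf _) (integrable_coeff hf _), ← integral_div]
  congr 1; ext x
  push_cast
  rw [cosT_eq, show -(k - m) = -k + m by abel, show -(k + m) = -k + -m by abel, mFourier_add,
    mFourier_add]
  ring

theorem coeff_mul_sinT {f : T2 → ℝ} (hf : Continuous f) (m k : Fin 2 → ℤ) :
    coeff (fun x => f x * sinT m x) k
      = (coeff f (k - m) - coeff f (k + m)) / 2 * (-Complex.I) := by
  simp only [coeff_def]
  rw [← integral_sub (integrable_coeff hf _) (integrable_coeff hf _), ← integral_div,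
    ← integral_mul_const]
  congr 1; ext x
  push_cast
  rw [sinT_eq, show -(k - m) = -k + m by abel, show -(k + m) = -k + -m by abel, mFourier_add,
    mFourier_add]
  ring

/-- Modulating a trigonometric polynomial by a large multiple of a nonzero frequency pushes its
Fourier coefficients out of any finite set. -/
theorem IsTrig.eventually_coeff_eq_zero {f : T2 → ℝ} (hf : IsTrig f) {v : Fin 2 → ℤ} (hv : v ≠ 0)
    (k : Fin 2 → ℤ) : ∀ᶠ N : ℕ in Filter.atTop, coeff f (k + (N : ℤ) • v) = 0 := by
  obtain ⟨s, hs, -⟩ := hf.eq_sum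
  have hinj : Function.Injective fun N : ℕ => k + (N : ℤ) • v := by
    intro a b hab
    have := smul_left_injective ℤ hv (add_left_cancel hab)
    exact_mod_cast this
  have := hinj.tendsto_cofinite.eventually (s.finite_toSet.compl_mem_cofinite)
  rw [Nat.cofinite_eq_atTop] at this
  exact this.mono fun N hN => hs _ (by simpa using hN)

theorem IsTrig.eventually_coeff_mul_cosT {f : T2 → ℝ} (hf : IsTrig f) {v : Fin 2 → ℤ}
    (hv : v ≠ 0) (k : Fin 2 → ℤ) :
    ∀ᶠ N : ℕ in Filter.atTop, coeff (fun x => f x * cosT ((N : ℤ) • v) x) k = 0 := by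
  filter_upwards [hf.eventually_coeff_eq_zero hv k,
    hf.eventually_coeff_eq_zero (neg_ne_zero.mpr hv) k] with N h1 h2
  rw [coeff_mul_cosT hf.continuous, h1, sub_eq_add_neg, ← smul_neg, h2]; simp

/-! ### Smooth functions and partial derivatives -/

theorem isOpenQuotientMap_lift :
    IsOpenQuotientMap fun (y : Fin 2 → ℝ) (i : Fin 2) => (y i : UnitAddCircle) :=
  IsOpenQuotientMap.piMap fun _ => QuotientAddGroup.isOpenQuotientMap_mk

theorem exists_lift (x : T2) : ∃ y : Fin 2 → ℝ, (fun i => (y i : UnitAddCircle)) = x :=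
  isOpenQuotientMap_lift.surjective x

namespace Smooth
variable {f g : T2 → ℝ}

theorem continuous (hf : Smooth f) : Continuous f :=
  isOpenQuotientMap_lift.isQuotientMap.continuous_iff.mpr (ContDiff.continuous hf)

theorem add (hf : Smooth f) (hg : Smooth g) : Smooth fun x => f x + g x := ContDiff.add hf hg

theorem sub (hf : Smooth f) (hg : Smooth g) : Smooth fun x => f x - g x := ContDiff.sub hf hg

theorem mul (hf : Smooth f) (hg : Smooth g) : Smooth fun x => f x * g x := ContDiff.mul hf hg

theorem const (c : ℝ) : Smooth fun _ => c := contDiff_const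

theorem differentiableAt (hf : Smooth f) (i : Fin 2) (x : T2) :
    DifferentiableAt ℝ (fun t : ℝ => f (x + Pi.single i (t : UnitAddCircle))) 0 := by
  obtain ⟨y, rfl⟩ := exists_lift x
  have h : (fun t : ℝ => f ((fun j => (y j : UnitAddCircle)) + Pi.single i (t : UnitAddCircle)))
      = (fun y : Fin 2 → ℝ => f fun i => (y i : UnitAddCircle)) ∘
        fun t : ℝ => y + Pi.single i t := by
    ext t
    refine congrArg f (funext fun j => ?_)
    by_cases hj : j = i
    · subst hj; simp
    · simp [hj]
  rw [h]
  refine ((ContDiff.differentiable hf (by simp)) _).comp _ ?_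
  refine differentiableAt_pi.mpr fun j => ?_
  by_cases hj : j = i
  · subst hj; simp only [Pi.add_apply, Pi.single_eq_same]; fun_prop
  · simp [hj]

theorem hasDerivAt (hf : Smooth f) (i : Fin 2) (x : T2) :
    HasDerivAt (fun t : ℝ => f (x + Pi.single i (t : UnitAddCircle))) (pd i f x) 0 :=
  (hf.differentiableAt i x).hasDerivAt

theorem pd_add (hf : Smooth f) (hg : Smooth g) (i : Fin 2) (x : T2) :
    pd i (fun y => f y + g y) x = pd i f x + pd i g x :=
  ((hf.hasDerivAt i x).add (hg.hasDerivAt i x)).deriv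

theorem pd_sub (hf : Smooth f) (hg : Smooth g) (i : Fin 2) (x : T2) :
    pd i (fun y => f y - g y) x = pd i f x - pd i g x :=
  ((hf.hasDerivAt i x).sub (hg.hasDerivAt i x)).deriv

theorem pd_mul (hf : Smooth f) (hg : Smooth g) (i : Fin 2) (x : T2) :
    pd i (fun y => f y * g y) x = pd i f x * g x + f x * pd i g x := by
  have := ((hf.hasDerivAt i x).mul (hg.hasDerivAt i x)).deriv
  refine Eq.trans ?_ (this.trans ?_)
  · rfl
  · simp

end Smooth

theorem pd_const_mul (c : ℝ) (f : T2 → ℝ) (i : Fin 2) (x : T2) :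
    pd i (fun y => c * f y) x = c * pd i f x := by
  simp only [pd]
  exact deriv_const_mul_field c

theorem pd_neg (f : T2 → ℝ) (i : Fin 2) (x : T2) : pd i (fun y => -f y) x = -pd i f x := by
  simpa using pd_const_mul (-1) f i x

theorem pd_const (c : ℝ) (i : Fin 2) (x : T2) : pd i (fun _ => c) x = 0 := by simp [pd]

theorem pd_sum {ι : Type*} (s : Finset ι) {f : ι → T2 → ℝ} (hf : ∀ i ∈ s, Smooth (f i))
    (i : Fin 2) (x : T2) : pd i (fun y => ∑ l ∈ s, f l y) x = ∑ l ∈ s, pd i (f l) x :=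
  (HasDerivAt.fun_sum fun l hl => (hf l hl).hasDerivAt i x).deriv

theorem mFourier_lift (k : Fin 2 → ℤ) (y : Fin 2 → ℝ) :
    mFourier k (fun i => (y i : UnitAddCircle))
      = ∏ i, Complex.exp (2 * Real.pi * Complex.I * k i * y i) := by
  simp only [mFourier, ContinuousMap.coe_mk]
  refine prod_congr rfl fun i _ => ?_
  rw [fourier_coe_apply]; simp

theorem contDiff_mFourier_lift (k : Fin 2 → ℤ) :
    ContDiff ℝ ∞ fun y : Fin 2 → ℝ => mFourier k (fun i => (y i : UnitAddCircle)) := by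
  simp only [mFourier_lift]
  refine contDiff_prod fun i _ => ?_
  refine ContDiff.cexp ?_
  refine contDiff_const.mul ?_
  exact Complex.ofRealCLM.contDiff.comp (contDiff_apply ℝ ℝ i)

theorem IsTrig.smooth {f : T2 → ℝ} (hf : IsTrig f) : Smooth f := by
  obtain ⟨s, -, h⟩ := hf.eq_sum
  have : f = fun x => (∑ k ∈ s, coeff f k * mFourier k x).re := by
    ext x; rw [← h]; simp
  rw [this, Smooth]
  refine Complex.reCLM.contDiff.comp ?_
  exact ContDiff.sum fun k _ => contDiff_const.mul (contDiff_mFourier_lift k)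

theorem hasDerivAt_mFourier (k : Fin 2 → ℤ) (i : Fin 2) (x : T2) :
    HasDerivAt (fun t : ℝ => mFourier k (x + Pi.single i (t : UnitAddCircle)))
      (2 * Real.pi * Complex.I * k i * mFourier k x) 0 := by
  have h : (fun t : ℝ => mFourier k (x + Pi.single i (t : UnitAddCircle)))
      = fun t : ℝ => mFourier k x * Complex.exp (2 * Real.pi * Complex.I * k i * t) := by
    ext t
    have h1 : mFourier k (x + Pi.single i (t : UnitAddCircle))
        = mFourier k x * mFourier k (Pi.single i (t : UnitAddCircle)) := by
      simp only [mFourier, ContinuousMap.coe_mk, ← prod_mul_distrib, fourier_apply, Pi.add_apply,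
        smul_add, AddCircle.toCircle_add, Circle.coe_mul]
    have h2 : (Pi.single i (t : UnitAddCircle) : T2)
        = fun j => ((Pi.single i t : Fin 2 → ℝ) j : UnitAddCircle) := by
      ext j
      by_cases hj : j = i
      · subst hj; simp
      · simp [hj]
    rw [h1, h2, mFourier_lift]
    congr 1
    rw [prod_eq_single i]
    · simp
    · intro j _ hj; simp [hj]
    · simp
  rw [h]
  have h3 : HasDerivAt (fun t : ℝ => 2 * Real.pi * Complex.I * k i * (t : ℂ))
      (2 * Real.pi * Complex.I * k i) 0 := by
    simpa using (Complex.ofRealCLM.hasDerivAt (x := (0 : ℝ))).const_mul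
      (2 * Real.pi * Complex.I * k i : ℂ)
  have := (h3.cexp).const_mul (mFourier k x)
  refine this.congr_deriv ?_
  simp only [Complex.ofReal_zero, mul_zero, Complex.exp_zero]
  ring

/-- Differentiation multiplies the Fourier coefficients of a trigonometric polynomial by
`2πi kᵢ`. -/
theorem IsTrig.pd_eq_sum {f : T2 → ℝ} (hf : IsTrig f) (i : Fin 2) : ∃ s : Finset (Fin 2 → ℤ),
    (∀ k ∉ s, coeff f k = 0) ∧ ∀ x, (pd i f x : ℂ)
      = ∑ k ∈ s, (2 * Real.pi * Complex.I * k i * coeff f k) * mFourier k x := by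
  obtain ⟨s, hs, h⟩ := hf.eq_sum
  refine ⟨s, hs, fun x => ?_⟩
  have h1 := (hf.smooth.hasDerivAt i x).ofReal_comp
  simp only [h] at h1
  refine h1.unique ?_
  refine (HasDerivAt.fun_sum fun k _ => (hasDerivAt_mFourier k i x).const_mul _).congr_deriv ?_
  exact sum_congr rfl fun k _ => by ring

theorem IsTrig.pd {f : T2 → ℝ} (hf : IsTrig f) (i : Fin 2) : IsTrig (pd i f) := by
  obtain ⟨s, -, h⟩ := hf.pd_eq_sum i
  exact isTrig_of_sum s _ h

theorem IsTrig.coeff_pd {f : T2 → ℝ} (hf : IsTrig f) (i : Fin 2) (k : Fin 2 → ℤ) :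
    coeff (StationaryNS.pd i f) k = 2 * Real.pi * Complex.I * k i * coeff f k := by
  obtain ⟨s, hs, h⟩ := hf.pd_eq_sum i
  rw [coeff_of_sum s _ h]
  split_ifs with hk
  · rfl
  · rw [hs k hk, mul_zero]

theorem IsTrig.pd_comm {f : T2 → ℝ} (hf : IsTrig f) (i j : Fin 2) (x : T2) :
    StationaryNS.pd i (StationaryNS.pd j f) x = StationaryNS.pd j (StationaryNS.pd i f) x := by
  refine ((hf.pd j).pd i).ext ((hf.pd i).pd j) (fun k => ?_) x
  rw [(hf.pd j).coeff_pd, (hf.pd i).coeff_pd, hf.coeff_pd, hf.coeff_pd]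
  ring

theorem pd_sinT (m : Fin 2 → ℤ) (i : Fin 2) (x : T2) :
    pd i (sinT m) x = 2 * Real.pi * m i * cosT m x := by
  have h := ((Complex.imCLM.hasFDerivAt).comp_hasDerivAt (0 : ℝ) (hasDerivAt_mFourier m i x)).deriv
  refine (h : pd i (sinT m) x = _).trans ?_
  simp [cosT]

/-! ### Intermittent amplitudes -/

theorem exists_trig_approx {g : T2 → ℝ} (hg : Continuous g) {δ : ℝ} (hδ : 0 < δ) :
    ∃ a, IsTrig a ∧ ∀ x, |a x - g x| ≤ δ := by
  have hmem : (⟨fun x => (g x : ℂ), by fun_prop⟩ : C(T2, ℂ))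
      ∈ (mFourierSubalgebra (Fin 2)).topologicalClosure := by
    rw [mFourierSubalgebra_closure_eq_top]; trivial
  obtain ⟨F, hF, hd⟩ := Metric.mem_closure_iff.mp hmem δ hδ
  refine ⟨fun x => (F x).re, ⟨(1 / 2 : ℂ) • (F + star F),
    SMulMemClass.smul_mem _ (add_mem hF (star_mem hF)), fun x => ?_⟩, fun x => ?_⟩
  · simp [Complex.add_conj]
  · have h1 := (ContinuousMap.dist_apply_le_dist x).trans hd.le
    rw [dist_comm, dist_eq_norm] at h1
    refine le_trans ?_ h1
    refine le_trans (le_of_eq ?_) (Complex.abs_re_le_norm _)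
    simp

/-- A normalised Riesz product: it is nonnegative, has small mean, and its square, which oscillates
at high frequencies around its mean `1`, does not change the Fourier coefficients of a given
trigonometric polynomial in a given finite set. -/
theorem exists_riesz_product {f : T2 → ℝ} (hf : IsTrig f) (S : Finset (Fin 2 → ℤ)) (n : ℕ) :
    ∃ h, IsTrig h ∧ (∀ x, 0 ≤ h x) ∧ ∫ x, h x ∂μT = Real.sqrt (2 / 3) ^ n ∧
      ∀ k ∈ S, coeff (fun x => f x * h x ^ 2) k = coeff f k := by
  induction n with
  | zero => exact ⟨fun _ => 1, .const 1, fun _ => zero_le_one, by simp, fun k _ => by simp⟩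
  | succ n ih =>
    obtain ⟨h, ht, h0, hint, hS⟩ := ih
    -- `(1 + cos)²` has mean `3 / 2`, so this factor keeps the mean of the square equal to `1`
    set r := Real.sqrt (2 / 3)
    have hr : r ^ 2 = 2 / 3 := Real.sq_sqrt (by norm_num)
    let v : Fin 2 → ℤ := Pi.single 0 1
    have hv : v ≠ 0 := by simp [v]
    have hv2 : v + v ≠ 0 := by
      intro h
      have := congrFun h 0
      simp [v] at this
    have hF : IsTrig fun x => f x * h x ^ 2 := by simpa [sq] using hf.mul (ht.mul ht)
    have e1 : ∀ᶠ N : ℕ in Filter.atTop, ∀ k ∈ S,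
        coeff (fun x => f x * h x ^ 2 * cosT ((N : ℤ) • v) x) k = 0 :=
      (Filter.eventually_all_finset S).mpr fun k _ => hF.eventually_coeff_mul_cosT hv k
    have e2 : ∀ᶠ N : ℕ in Filter.atTop, ∀ k ∈ S,
        coeff (fun x => f x * h x ^ 2 * cosT ((N : ℤ) • (v + v)) x) k = 0 :=
      (Filter.eventually_all_finset S).mpr fun k _ => hF.eventually_coeff_mul_cosT hv2 k
    obtain ⟨N, h1, h2, h3⟩ := (e1.and (e2.and (ht.eventually_coeff_mul_cosT hv 0))).exists
    have hc := isTrig_cosT ((N : ℤ) • v)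
    have hc2 := isTrig_cosT ((N : ℤ) • (v + v))
    refine ⟨fun x => r * (h x + h x * cosT ((N : ℤ) • v) x),
      (ht.add (ht.mul hc)).const_mul r, fun x => ?_, ?_, fun k hk => ?_⟩
    · have := neg_le_of_abs_le (abs_cosT_le ((N : ℤ) • v) x)
      have h0x := h0 x
      refine mul_nonneg (Real.sqrt_nonneg _) ?_
      nlinarith
    · rw [coeff_zero] at h3
      rw [integral_const_mul, integral_add (integrable_of_continuous ht.continuous)
        (integrable_of_continuous (ht.mul hc).continuous), hint]
      have : ∫ x, h x * cosT ((N : ℤ) • v) x ∂μT = 0 := by exact_mod_cast h3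
      rw [this, add_zero, pow_succ']
    · have key : (fun x => f x * (r * (h x + h x * cosT ((N : ℤ) • v) x)) ^ 2)
          = fun x => f x * h x ^ 2 + (4 / 3 * (f x * h x ^ 2 * cosT ((N : ℤ) • v) x)
            + 1 / 3 * (f x * h x ^ 2 * cosT ((N : ℤ) • (v + v)) x)) := by
        ext x
        have hcc := cosT_mul_cosT ((N : ℤ) • v) ((N : ℤ) • v) x
        rw [sub_self, cosT_zero, ← smul_add] at hcc
        linear_combination (f x * h x ^ 2 * (1 + cosT ((N : ℤ) • v) x) ^ 2) * hr
          + 2 / 3 * (f x * h x ^ 2) * hcc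
      have t1 := (hF.mul hc).const_mul (4 / 3)
      have t2 := (hF.mul hc2).const_mul (1 / 3)
      rw [key, coeff_add hF.continuous (t1.add t2).continuous,
        coeff_add t1.continuous t2.continuous, coeff_const_mul, coeff_const_mul, h1 k hk, h2 k hk,
        hS k hk]
      simp

/-- Intermittency: up to a small error, the low Fourier modes of a nonnegative continuous function
are those of the square of a trigonometric polynomial which is bounded in `L²` and small in
`L¹`. -/
theorem exists_intermittent_sqrt {g : T2 → ℝ} (hg : Continuous g) (hg0 : ∀ x, 0 ≤ g x) :
    ∃ B : ℝ, ∀ ε > 0, ∀ S : Finset (Fin 2 → ℤ), ∃ A, IsTrig A ∧ ∫ x, |A x| ∂μT ≤ ε ∧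
      ∫ x, A x ^ 2 ∂μT ≤ B ∧ ∀ k ∈ S, ‖coeff (fun x => A x ^ 2) k - coeff g k‖ ≤ ε := by
  obtain ⟨M, hM⟩ := exists_bound_of_continuous (f := fun x => Real.sqrt (g x)) (by fun_prop)
  have hM0 : 0 ≤ M := (abs_nonneg _).trans (hM 0)
  refine ⟨(M + 1) ^ 2, fun ε hε S => ?_⟩
  obtain ⟨a, ha, had⟩ := exists_trig_approx (g := fun x => Real.sqrt (g x)) (by fun_prop)
    (δ := min 1 (ε / (2 * M + 1))) (by positivity)
  have ha1 : ∀ x, |a x| ≤ M + 1 := fun x => by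
    have h1 := (had x).trans (min_le_left _ _)
    have h2 := hM x
    have h3 := abs_add_le (a x - Real.sqrt (g x)) (Real.sqrt (g x))
    rw [sub_add_cancel] at h3
    linarith
  have hsq : ∀ x, |a x ^ 2 - g x| ≤ ε := fun x => by
    have h1 := (had x).trans (min_le_right _ _)
    have h3 : |a x + Real.sqrt (g x)| ≤ 2 * M + 1 := by
      have := abs_add_le (a x) (Real.sqrt (g x))
      have := hM x
      have := ha1 x
      linarith
    have h4 : a x ^ 2 - g x = (a x - Real.sqrt (g x)) * (a x + Real.sqrt (g x)) := by
      linear_combination Real.sq_sqrt (hg0 x)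
    rw [h4, abs_mul]
    calc _ ≤ ε / (2 * M + 1) * (2 * M + 1) := by gcongr
      _ = ε := by field_simp
  have ha2 : IsTrig fun x => a x ^ 2 := by simpa [sq] using ha.mul ha
  obtain ⟨n, hn⟩ := exists_pow_lt_of_lt_one (y := Real.sqrt (2 / 3)) (x := ε / (M + 1))
    (by positivity) (by rw [Real.sqrt_lt' one_pos]; norm_num)
  obtain ⟨h, ht, h0, hint, hS⟩ := exists_riesz_product ha2 (insert 0 S) n
  have hAt := ha.mul ht
  have hA2 : (fun x => (a x * h x) ^ 2) = fun x => a x ^ 2 * h x ^ 2 := by ext x; ring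
  refine ⟨fun x => a x * h x, hAt, ?_, ?_, fun k hk => ?_⟩
  · have hcont := hAt.continuous
    calc ∫ x, |a x * h x| ∂μT ≤ ∫ x, (M + 1) * h x ∂μT := by
          refine integral_mono (integrable_of_continuous (by fun_prop))
            (integrable_of_continuous (ht.const_mul _).continuous) fun x => ?_
          simp only [abs_mul, abs_of_nonneg (h0 x)]
          exact mul_le_mul_of_nonneg_right (ha1 x) (h0 x)
      _ = (M + 1) * Real.sqrt (2 / 3) ^ n := by rw [integral_const_mul, hint]
      _ ≤ (M + 1) * (ε / (M + 1)) := by gcongr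
      _ = ε := by field_simp
  · have h1 := hS 0 (mem_insert_self _ _)
    rw [coeff_zero, coeff_zero] at h1
    have h2 : ∫ x, a x ^ 2 * h x ^ 2 ∂μT = ∫ x, a x ^ 2 ∂μT := by exact_mod_cast h1
    rw [hA2, h2]
    calc _ ≤ ∫ _, (M + 1) ^ 2 ∂μT := by
          refine integral_mono (integrable_of_continuous ha2.continuous) (integrable_const _)
            fun x => ?_
          simp only
          rw [← sq_abs]
          gcongr
          exact ha1 x
      _ = _ := by simp
  · rw [hA2, hS k (mem_insert_of_mem hk), ← coeff_sub ha2.continuous hg]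
    exact norm_coeff_le_of_bound hsq k

/-! ### Highly oscillating stream functions -/

/-- The four wave vectors of the building blocks. -/
def waveVec : Fin 4 → Fin 2 → ℤ := ![![1, 0], ![0, 1], ![1, 1], ![1, -1]]

theorem waveVec_add_ne_zero (l l' : Fin 4) : waveVec l + waveVec l' ≠ 0 := by
  revert l l'; decide

theorem waveVec_sub_ne_zero {l l' : Fin 4} (h : l ≠ l') : waveVec l - waveVec l' ≠ 0 := by
  revert l l'; decide

theorem abs_waveVec_le (l : Fin 4) (a : Fin 2) : |(waveVec l a : ℝ)| ≤ 1 := by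
  have : |waveVec l a| ≤ 1 := by revert l a; decide
  exact_mod_cast this

/-- The stream function with amplitudes `A l`, oscillating at the frequencies `N • waveVec l`. -/
def stream (A : Fin 4 → T2 → ℝ) (N : ℕ) (x : T2) : ℝ :=
  ∑ l, (2 * Real.pi * N)⁻¹ * (A l x * sinT ((N : ℤ) • waveVec l) x)

/-- The leading part of `pd a (stream A N)`, in which only the oscillation is differentiated. -/
def streamMain (A : Fin 4 → T2 → ℝ) (N : ℕ) (a : Fin 2) (x : T2) : ℝ :=
  ∑ l, waveVec l a * (A l x * cosT ((N : ℤ) • waveVec l) x)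

/-- The remainder of `pd a (stream A N)`, up to the factor `(2πN)⁻¹`. -/
def streamRem (A : Fin 4 → T2 → ℝ) (N : ℕ) (a : Fin 2) (x : T2) : ℝ :=
  ∑ l, pd a (A l) x * sinT ((N : ℤ) • waveVec l) x

section
variable {A : Fin 4 → T2 → ℝ} (hA : ∀ l, IsTrig (A l))
include hA

theorem isTrig_stream (N : ℕ) : IsTrig (stream A N) :=
  IsTrig.sum _ fun l _ => ((hA l).mul (isTrig_sinT _)).const_mul _

theorem isTrig_streamMain (N : ℕ) (a : Fin 2) : IsTrig (streamMain A N a) :=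
  IsTrig.sum _ fun l _ => ((hA l).mul (isTrig_cosT _)).const_mul _

theorem pd_stream {N : ℕ} (hN : 0 < N) (a : Fin 2) (x : T2) :
    pd a (stream A N) x = streamMain A N a x + (2 * Real.pi * N)⁻¹ * streamRem A N a x := by
  have hpi := Real.pi_pos
  have hN' : (0 : ℝ) < N := by exact_mod_cast hN
  simp only [streamMain, streamRem]
  rw [mul_sum, ← sum_add_distrib]
  refine (pd_sum _ (fun l _ => (((hA l).mul (isTrig_sinT _)).const_mul _).smooth) a x).trans ?_
  refine sum_congr rfl fun l _ => ?_
  rw [pd_const_mul, (hA l).smooth.pd_mul (isTrig_sinT _).smooth, pd_sinT]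
  simp only [Pi.smul_apply, smul_eq_mul]
  push_cast
  field_simp
  ring

theorem exists_stream_bounds : ∃ D : ℝ, 0 ≤ D ∧ ∀ N a x,
    |streamMain A N a x| ≤ D ∧ |streamRem A N a x| ≤ D := by
  choose M hM using fun l => exists_bound_of_continuous (hA l).continuous
  choose M' hM' using fun l a => exists_bound_of_continuous ((hA l).pd a).continuous
  have h0 : ∀ l, 0 ≤ M l := fun l => (abs_nonneg _).trans (hM l 0)
  have h0' : ∀ l a, 0 ≤ M' l a := fun l a => (abs_nonneg _).trans (hM' l a 0)
  have hs : ∀ a, 0 ≤ ∑ l, M' l a := fun a => sum_nonneg fun l _ => h0' l a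
  refine ⟨∑ l, M l + ∑ a, ∑ l, M' l a,
    add_nonneg (sum_nonneg fun l _ => h0 l) (sum_nonneg fun a _ => hs a),
    fun N a x => ⟨?_, ?_⟩⟩
  · refine (abs_sum_le_sum_abs _ _).trans (le_trans (sum_le_sum fun l _ => ?_)
      (le_add_of_nonneg_right (sum_nonneg fun a _ => hs a)))
    rw [abs_mul, abs_mul]
    calc _ ≤ 1 * (M l * 1) := by
          gcongr
          exacts [abs_waveVec_le l a, h0 l, hM l x, abs_cosT_le _ x]
      _ = M l := by ring
  · refine (abs_sum_le_sum_abs _ _).trans ?_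
    refine le_trans (sum_le_sum (g := fun l => M' l a) fun l _ => ?_) ?_
    · rw [abs_mul]
      calc _ ≤ M' l a * 1 := by
            gcongr
            exacts [h0' l a, hM' l a x, abs_sinT_le _ x]
        _ = M' l a := by ring
    · exact (single_le_sum (f := fun a => ∑ l, M' l a) (fun a _ => hs a) (mem_univ a)).trans
        (le_add_of_nonneg_left (sum_nonneg fun l _ => h0 l))

/-- The low modes of the products of the leading parts are those of the squared amplitudes; the
interactions of different blocks are of high frequency. -/
theorem eventually_coeff_streamMain (a b : Fin 2) (k : Fin 2 → ℤ) :
    ∀ᶠ N : ℕ in Filter.atTop, coeff (fun x => streamMain A N a x * streamMain A N b x) k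
      = ∑ l, (waveVec l a * waveVec l b : ℝ) / 2 * coeff (fun x => A l x ^ 2) k := by
  have hAA : ∀ l l', IsTrig fun x => A l x * A l' x := fun l l' => (hA l).mul (hA l')
  have e1 : ∀ᶠ N : ℕ in Filter.atTop, ∀ l l', coeff (fun x => A l x * A l' x *
      cosT ((N : ℤ) • (waveVec l + waveVec l')) x) k = 0 := by
    refine Filter.eventually_all.mpr fun l => Filter.eventually_all.mpr fun l' => ?_
    exact (hAA l l').eventually_coeff_mul_cosT (waveVec_add_ne_zero l l') k
  have e2 : ∀ᶠ N : ℕ in Filter.atTop, ∀ l l', coeff (fun x => A l x * A l' x *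
      cosT ((N : ℤ) • (waveVec l - waveVec l')) x) k
        = if l = l' then coeff (fun x => A l x ^ 2) k else 0 := by
    refine Filter.eventually_all.mpr fun l => Filter.eventually_all.mpr fun l' => ?_
    by_cases h : l = l'
    · subst h
      refine Filter.Eventually.of_forall fun N => ?_
      simp [cosT_zero, sq]
    · simp only [if_neg h]
      exact (hAA l l').eventually_coeff_mul_cosT (waveVec_sub_ne_zero h) k
  filter_upwards [e1, e2] with N h1 h2
  have hc : ∀ l l' m, IsTrig fun x => A l x * A l' x * cosT m x :=
    fun l l' m => (hAA l l').mul (isTrig_cosT m)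
  have key : (fun x => streamMain A N a x * streamMain A N b x) = fun x => ∑ l, ∑ l',
      (waveVec l a * waveVec l' b / 2 : ℝ) *
        (A l x * A l' x * cosT ((N : ℤ) • (waveVec l + waveVec l')) x
          + A l x * A l' x * cosT ((N : ℤ) • (waveVec l - waveVec l')) x) := by
    ext x
    simp only [streamMain, sum_mul_sum]
    refine sum_congr rfl fun l _ => sum_congr rfl fun l' _ => ?_
    have := cosT_mul_cosT ((N : ℤ) • waveVec l) ((N : ℤ) • waveVec l') x
    rw [← smul_add, ← smul_sub] at this
    linear_combination (waveVec l a * waveVec l' b * (A l x * A l' x)) * this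
  rw [key, coeff_sum _ fun l _ => (IsTrig.sum _ fun l' _ =>
    ((hc l l' _).add (hc l l' _)).const_mul _).continuous]
  refine sum_congr rfl fun l _ => ?_
  rw [coeff_sum _ fun l' _ => (((hc l l' _).add (hc l l' _)).const_mul _).continuous]
  simp only [coeff_const_mul, coeff_add (hc _ _ _).continuous (hc _ _ _).continuous, h1, h2,
    zero_add, mul_ite, mul_zero]
  simp

theorem eventually_coeff_pd_stream (a b : Fin 2) (k : Fin 2 → ℤ) {ε : ℝ} (hε : 0 < ε) :
    ∀ᶠ N : ℕ in Filter.atTop, ‖coeff (fun x => pd a (stream A N) x * pd b (stream A N) x) k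
      - ∑ l, (waveVec l a * waveVec l b : ℝ) / 2 * coeff (fun x => A l x ^ 2) k‖ ≤ ε := by
  obtain ⟨D, hD0, hD⟩ := exists_stream_bounds hA
  have hlim : ∀ᶠ N : ℕ in Filter.atTop, 3 * D ^ 2 / (N : ℝ) ≤ ε :=
    (tendsto_const_div_atTop_nhds_zero_nat _).eventually_le_const hε
  filter_upwards [eventually_coeff_streamMain hA a b k, hlim, Filter.eventually_ge_atTop 1]
    with N h1 h2 hN
  have hN' : (1 : ℝ) ≤ N := by exact_mod_cast hN
  have hpi := Real.pi_gt_three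
  have ht := isTrig_stream hA N
  rw [← h1, ← coeff_sub ((ht.pd a).mul (ht.pd b)).continuous
    ((isTrig_streamMain hA N a).mul (isTrig_streamMain hA N b)).continuous]
  refine (norm_coeff_le_of_bound (fun x => ?_) k).trans h2
  have hc1 : (2 * Real.pi * N)⁻¹ ≤ 1 / (N : ℝ) := by
    rw [one_div]; gcongr; nlinarith
  have hc0 : 0 ≤ (2 * Real.pi * N)⁻¹ := by positivity
  have hc2 : (2 * Real.pi * N)⁻¹ ≤ 1 := hc1.trans (by rw [div_le_one (by linarith)]; exact hN')
  rw [pd_stream hA hN, pd_stream hA hN]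
  set c := (2 * Real.pi * N)⁻¹
  obtain ⟨ma, ra⟩ := hD N a x
  obtain ⟨mb, rb⟩ := hD N b x
  have key : (streamMain A N a x + c * streamRem A N a x)
      * (streamMain A N b x + c * streamRem A N b x) - streamMain A N a x * streamMain A N b x
      = c * (streamMain A N a x * streamRem A N b x + streamRem A N a x * streamMain A N b x
        + c * (streamRem A N a x * streamRem A N b x)) := by ring
  rw [key, abs_mul, abs_of_nonneg hc0]
  calc _ ≤ 1 / (N : ℝ) * (D * D + D * D + 1 * (D * D)) := by
        gcongr
        refine (abs_add_le _ _).trans (add_le_add ((abs_add_le _ _).trans (add_le_add ?_ ?_)) ?_)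
        · rw [abs_mul]; gcongr
        · rw [abs_mul]; gcongr
        · rw [abs_mul, abs_mul, abs_of_nonneg hc0]; gcongr
    _ = _ := by ring

theorem eventually_integral_abs_pd_stream (a : Fin 2) {ε : ℝ} (hε : 0 < ε) :
    ∀ᶠ N : ℕ in Filter.atTop,
      ∫ x, |pd a (stream A N) x| ∂μT ≤ ∑ l, ∫ x, |A l x| ∂μT + ε ∧
      ∫ x, pd a (stream A N) x ^ 2 ∂μT ≤ 8 * ∑ l, ∫ x, A l x ^ 2 ∂μT + ε := by
  obtain ⟨D, hD0, hD⟩ := exists_stream_bounds hA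
  have hlim : ∀ᶠ N : ℕ in Filter.atTop, D / (N : ℝ) ≤ ε :=
    (tendsto_const_div_atTop_nhds_zero_nat _).eventually_le_const hε
  have hlim2 : ∀ᶠ N : ℕ in Filter.atTop, 2 * D ^ 2 / (N : ℝ) ≤ ε :=
    (tendsto_const_div_atTop_nhds_zero_nat _).eventually_le_const hε
  filter_upwards [hlim, hlim2, Filter.eventually_ge_atTop 1] with N h1 h2 hN
  have hN' : (1 : ℝ) ≤ N := by exact_mod_cast hN
  have hpi := Real.pi_gt_three
  have hcont : ∀ l, Continuous (A l) := fun l => (hA l).continuous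
  have hpc := ((isTrig_stream hA N).pd a).continuous
  have hc1 : (2 * Real.pi * N)⁻¹ ≤ 1 / (N : ℝ) := by
    rw [one_div]; gcongr; nlinarith
  have hc0 : 0 ≤ (2 * Real.pi * N)⁻¹ := by positivity
  have hc2 : (2 * Real.pi * N)⁻¹ ≤ 1 := hc1.trans (by rw [div_le_one (by linarith)]; exact hN')
  have hmain : ∀ x, |streamMain A N a x| ≤ ∑ l, |A l x| := fun x => by
    refine (abs_sum_le_sum_abs _ _).trans (sum_le_sum fun l _ => ?_)
    rw [abs_mul, abs_mul]
    calc _ ≤ 1 * (|A l x| * 1) := by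
          gcongr
          exacts [abs_waveVec_le l a, abs_cosT_le _ x]
      _ = _ := by ring
  have hrem : ∀ x, |(2 * Real.pi * N)⁻¹ * streamRem A N a x| ≤ D / N := fun x => by
    rw [abs_mul, abs_of_nonneg hc0]
    calc _ ≤ 1 / (N : ℝ) * D := by gcongr; exact (hD N a x).2
      _ = _ := by ring
  have hDN : D / (N : ℝ) ≤ D := div_le_self hD0 hN'
  constructor
  · calc _ ≤ ∫ x, (∑ l, |A l x| + ε) ∂μT := by
          refine integral_mono (integrable_of_continuous (by fun_prop))
            (integrable_of_continuous (by fun_prop)) fun x => ?_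
          simp only
          rw [pd_stream hA hN]
          exact (abs_add_le _ _).trans (add_le_add (hmain x) ((hrem x).trans h1))
      _ = _ := by
          rw [integral_add (integrable_of_continuous (by fun_prop)) (integrable_const _),
            integral_finsetSum _ fun l _ => integrable_of_continuous (by fun_prop)]
          simp
  · calc _ ≤ ∫ x, (8 * ∑ l, A l x ^ 2 + ε) ∂μT := by
          refine integral_mono (integrable_of_continuous (by fun_prop))
            (integrable_of_continuous (by fun_prop)) fun x => ?_
          simp only
          rw [pd_stream hA hN]
          have q1 : streamMain A N a x ^ 2 ≤ 4 * ∑ l, A l x ^ 2 := by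
            rw [← sq_abs]
            calc _ ≤ (∑ l, |A l x|) ^ 2 := by gcongr; exact hmain x
              _ ≤ _ := by
                have := sq_sum_le_card_mul_sum_sq (s := (univ : Finset (Fin 4)))
                  (f := fun l => |A l x|)
                simpa using this
          have q2 : ((2 * Real.pi * N)⁻¹ * streamRem A N a x) ^ 2 ≤ D ^ 2 / N := by
            rw [← sq_abs]
            calc _ ≤ (D / N) ^ 2 := by gcongr; exact hrem x
              _ ≤ D * (D / N) := by rw [sq]; gcongr
              _ = _ := by ring
          have q3 : 2 * (D ^ 2 / N) ≤ ε := by rw [← mul_div_assoc]; exact h2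
          have q4 := add_sq_le (a := streamMain A N a x)
            (b := (2 * Real.pi * N)⁻¹ * streamRem A N a x)
          linarith
      _ = _ := by
          rw [integral_add (integrable_of_continuous (by fun_prop)) (integrable_const _),
            integral_const_mul,
            integral_finsetSum _ fun l _ => integrable_of_continuous (by fun_prop)]
          simp

end

/-! ### Localisation in a Littlewood-Paley shell -/

theorem freq_add (k l : Fin 2 → ℤ) : freq (k + l) = freq k + freq l := by
  ext i; simp [freq]

theorem freq_neg (k : Fin 2 → ℤ) : freq (-k) = -freq k := by
  ext i; simp [freq]

theorem freq_natCast_smul (N : ℕ) (k : Fin 2 → ℤ) : freq ((N : ℤ) • k) = (N : ℝ) • freq k := by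
  ext i; simp [freq]

theorem norm_freq_sq (k : Fin 2 → ℤ) : ‖freq k‖ ^ 2 = (k 0 : ℝ) ^ 2 + (k 1 : ℝ) ^ 2 := by
  simp [EuclideanSpace.norm_sq_eq, freq]

theorem norm_freq_waveVec (l : Fin 4) : 1 ≤ ‖freq (waveVec l)‖ ∧ ‖freq (waveVec l)‖ ≤ 71 / 50 := by
  have h := norm_freq_sq (waveVec l)
  have hn := norm_nonneg (freq (waveVec l))
  have : ‖freq (waveVec l)‖ ^ 2 = 1 ∨ ‖freq (waveVec l)‖ ^ 2 = 2 := by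
    rw [h]; fin_cases l <;> norm_num [waveVec]
  rcases this with h | h <;> constructor <;> nlinarith

/-- The flat part `2ʲ ≤ |k| ≤ (12/7) 2ʲ` of the `j`-th shell, on which `dil φ j` equals `1`. -/
def InShell (j : ℕ) (k : Fin 2 → ℤ) : Prop :=
  (2 : ℝ) ^ j ≤ ‖freq k‖ ∧ ‖freq k‖ ≤ 12 / 7 * 2 ^ j

theorem InShell.dil_eq_one {φ : E2 → ℝ} (hφ : IsLPBump φ) {j : ℕ} {k : Fin 2 → ℤ}
    (h : InShell j k) : dil φ j (freq k) = 1 := by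
  have h2 : (0 : ℝ) < 2 ^ j := by positivity
  obtain ⟨h0, h1⟩ := h
  refine hφ.eq_one _ ?_ ?_ <;>
    rw [norm_smul, norm_inv, norm_pow, Real.norm_ofNat, inv_mul_eq_div]
  · rwa [le_div_iff₀ h2, one_mul]
  · rwa [div_le_iff₀ h2]

/-- With `N = 9 * 2 ^ i`, both `N` and `√2 N`, the lengths of the vectors `N • waveVec l`, lie in
the interior of the flat part of the shell `j = i + 3`. -/
theorem eventually_stream_inShell {A : Fin 4 → T2 → ℝ} (hA : ∀ l, IsTrig (A l)) :
    ∀ᶠ i : ℕ in Filter.atTop, ∀ k, coeff (stream A (9 * 2 ^ i)) k ≠ 0 → InShell (i + 3) k := by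
  choose s hs _ using fun l => (hA l).eq_sum
  obtain ⟨ρ, hρ⟩ : ∃ ρ : ℝ, ∀ l, ∀ k, coeff (A l) k ≠ 0 → ‖freq k‖ ≤ ρ := by
    refine ⟨∑ l, ∑ k ∈ s l, ‖freq k‖, fun l k hk => ?_⟩
    have hk' : k ∈ s l := by
      by_contra h
      exact hk (hs l k h)
    exact (single_le_sum (f := fun k => ‖freq k‖) (fun _ _ => norm_nonneg _) hk').trans
      (single_le_sum (f := fun l => ∑ k ∈ s l, ‖freq k‖)
        (fun _ _ => sum_nonneg fun _ _ => norm_nonneg _) (mem_univ l))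
  have hlim : ∀ᶠ i : ℕ in Filter.atTop, 2 * ρ ≤ (2 : ℝ) ^ i :=
    (tendsto_pow_atTop_atTop_of_one_lt one_lt_two).eventually_ge_atTop _
  filter_upwards [hlim] with i hi k hk
  have hk2 : ∃ l, coeff (A l) (k - ((9 * 2 ^ i : ℕ) : ℤ) • waveVec l) ≠ 0
      ∨ coeff (A l) (k + ((9 * 2 ^ i : ℕ) : ℤ) • waveVec l) ≠ 0 := by
    by_contra! hcon
    refine hk ?_
    unfold stream
    rw [coeff_sum _ fun l _ => (((hA l).mul (isTrig_sinT _)).const_mul _).continuous]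
    refine sum_eq_zero fun l _ => ?_
    rw [coeff_const_mul, coeff_mul_sinT (hA l).continuous, (hcon l).1, (hcon l).2]
    simp
  have main : ∀ l, ∀ m v : Fin 2 → ℤ, ‖freq v‖ = ‖freq (waveVec l)‖ →
      coeff (A l) m ≠ 0 → k = m + ((9 * 2 ^ i : ℕ) : ℤ) • v → InShell (i + 3) k := by
    intro l m v hv hm hkm
    have h1 := hρ l m hm
    obtain ⟨h2, h3⟩ := norm_freq_waveVec l
    rw [← hv] at h2 h3
    have hpos : (0 : ℝ) < 2 ^ i := by positivity
    have e : freq k = freq m + (9 * 2 ^ i : ℝ) • freq v := by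
      rw [hkm, freq_add, freq_natCast_smul]; push_cast; rfl
    have en : ‖(9 * 2 ^ i : ℝ) • freq v‖ = 9 * 2 ^ i * ‖freq v‖ := by
      rw [norm_smul, Real.norm_of_nonneg (by positivity)]
    have u1 := norm_add_le (freq m) ((9 * 2 ^ i : ℝ) • freq v)
    have u2 := norm_sub_le (freq m + (9 * 2 ^ i : ℝ) • freq v) (freq m)
    rw [add_sub_cancel_left] at u2
    rw [en, ← e] at u1 u2
    have e3 : (2 : ℝ) ^ (i + 3) = 8 * 2 ^ i := by ring
    rw [InShell, e3]
    constructor <;> nlinarith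
  obtain ⟨l, h | h⟩ := hk2
  · exact main l _ (waveVec l) rfl h (by abel)
  · exact main l _ (-waveVec l) (by rw [freq_neg, norm_neg]) h (by rw [smul_neg]; abel)

/-- Trigonometric stream functions, localised in a high shell, with velocities bounded in `L²` and
small in `L¹`, whose quadratic averages approximate a given symmetric matrix field modulo constant
multiples of the identity. -/
theorem exists_stream {Q : Fin 2 → Fin 2 → T2 → ℝ} (hQ : ∀ a b, Continuous (Q a b))
    (hsymm : Q 1 0 = Q 0 1) :
    ∃ B : ℝ, ∀ ε > 0, ∀ S : Finset (Fin 2 → ℤ), ∀ J : ℕ, ∃ ψ, IsTrig ψ ∧ ∃ j, J ≤ j ∧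
      (∀ k, coeff ψ k ≠ 0 → InShell j k) ∧
      (∀ a, ∫ x, |pd a ψ x| ∂μT ≤ ε) ∧ (∀ a, ∫ x, pd a ψ x ^ 2 ∂μT ≤ B) ∧
      ∀ a b, ∀ k ∈ S, k ≠ 0 → ‖coeff (fun x => pd a ψ x * pd b ψ x) k - coeff (Q a b) k‖ ≤ ε := by
  choose M hM using fun a b => exists_bound_of_continuous (hQ a b)
  set c := M 0 0 + M 1 1 + M 0 1
  have hM0 : ∀ a b, 0 ≤ M a b := fun a b => (abs_nonneg _).trans (hM a b 0)
  -- `Q + 3c` is half the combination of the matrices `v ⊗ v`, `v = waveVec l`, with weights `g l`,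
  -- and `c` is large enough to make the weights nonnegative
  let g : Fin 4 → T2 → ℝ := ![fun x => 2 * c + 2 * Q 0 0 x, fun x => 2 * c + 2 * Q 1 1 x,
    fun x => 2 * c + Q 0 1 x, fun x => 2 * c + (-1) * Q 0 1 x]
  have hg : ∀ l, Continuous (g l) := by
    have h00 := hQ 0 0
    have h11 := hQ 1 1
    have h01 := hQ 0 1
    intro l; fin_cases l <;> simp only [g] <;> dsimp <;> fun_prop
  have hg0 : ∀ l x, 0 ≤ g l x := by
    intro l x
    have b00 := abs_le.mp (hM 0 0 x)
    have b11 := abs_le.mp (hM 1 1 x)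
    have b01 := abs_le.mp (hM 0 1 x)
    have n00 := hM0 0 0
    have n11 := hM0 1 1
    have n01 := hM0 0 1
    fin_cases l <;> simp [g, c] <;> linarith
  have hrep : ∀ a b k, k ≠ 0 →
      ∑ l, (waveVec l a * waveVec l b : ℝ) / 2 * coeff (g l) k = coeff (Q a b) k := by
    intro a b k hk
    have c0 : coeff (g 0) k = 2 * coeff (Q 0 0) k := by
      have := coeff_add (f := fun _ => 2 * c) (g := fun x => 2 * Q 0 0 x) continuous_const
        ((hQ 0 0).const_mul 2) k
      rw [coeff_const _ hk, coeff_const_mul, zero_add] at this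
      simpa [g] using this
    have c1 : coeff (g 1) k = 2 * coeff (Q 1 1) k := by
      have := coeff_add (f := fun _ => 2 * c) (g := fun x => 2 * Q 1 1 x) continuous_const
        ((hQ 1 1).const_mul 2) k
      rw [coeff_const _ hk, coeff_const_mul, zero_add] at this
      simpa [g] using this
    have c2 : coeff (g 2) k = coeff (Q 0 1) k := by
      have := coeff_add (f := fun _ => 2 * c) (g := fun x => Q 0 1 x) continuous_const
        (hQ 0 1) k
      rw [coeff_const _ hk, zero_add] at this
      simpa [g] using this
    have c3 : coeff (g 3) k = -coeff (Q 0 1) k := by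
      have := coeff_add (f := fun _ => 2 * c) (g := fun x => (-1) * Q 0 1 x) continuous_const
        ((hQ 0 1).const_mul (-1)) k
      rw [coeff_const _ hk, coeff_const_mul, zero_add] at this
      simpa [g] using this
    rw [Fin.sum_univ_four, c0, c1, c2, c3]
    fin_cases a <;> fin_cases b <;> simp [waveVec, hsymm] <;> ring
  choose B hB using fun l => exists_intermittent_sqrt (hg l) (hg0 l)
  refine ⟨8 * ∑ l, B l + 1, fun ε hε S J => ?_⟩
  -- half of `ε` pays for the amplitudes, the rest for the finite frequency `N`
  set δ := min 1 (ε / 8)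
  have hδ : 0 < δ := by positivity
  have hδ1 : δ ≤ 1 := min_le_left _ _
  have hδε : δ ≤ ε / 8 := min_le_right _ _
  choose A hA hA1 hA2 hAS using fun l => hB l δ hδ S
  have hN : Filter.Tendsto (fun i : ℕ => 9 * 2 ^ i) Filter.atTop Filter.atTop :=
    Filter.Tendsto.const_mul_atTop' (by norm_num) (tendsto_pow_atTop_atTop_of_one_lt one_lt_two)
  have ev1 := Filter.eventually_all.mpr fun a => hN.eventually
    (eventually_integral_abs_pd_stream hA a hδ)
  have ev2 := Filter.eventually_all.mpr fun a => Filter.eventually_all.mpr fun b => hN.eventually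
    ((Filter.eventually_all_finset S).mpr fun k _ => eventually_coeff_pd_stream hA a b k hδ)
  obtain ⟨i, h1, h2, h3, h4⟩ := (ev1.and (ev2.and ((eventually_stream_inShell hA).and
    (Filter.eventually_ge_atTop J)))).exists
  refine ⟨stream A (9 * 2 ^ i), isTrig_stream hA _, i + 3, by omega, h3, fun a => ?_, fun a => ?_,
    fun a b k hk hk0 => ?_⟩
  · refine (h1 a).1.trans ?_
    have : ∑ l, ∫ x, |A l x| ∂μT ≤ ∑ _l : Fin 4, δ := sum_le_sum fun l _ => hA1 l
    simp at this
    linarith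
  · refine (h1 a).2.trans ?_
    have : ∑ l, ∫ x, A l x ^ 2 ∂μT ≤ ∑ l, B l := sum_le_sum fun l _ => hA2 l
    linarith
  · have e1 := h2 a b k hk
    rw [← hrep a b k hk0]
    have e2 : ‖∑ l, (waveVec l a * waveVec l b : ℝ) / 2 * coeff (fun x => A l x ^ 2) k
        - ∑ l, (waveVec l a * waveVec l b : ℝ) / 2 * coeff (g l) k‖ ≤ ∑ _l : Fin 4, δ := by
      rw [← sum_sub_distrib]
      refine (norm_sum_le _ _).trans (sum_le_sum fun l _ => ?_)
      rw [← mul_sub, norm_mul]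
      calc _ ≤ 1 * δ := by
            gcongr
            · rw [norm_div, Complex.norm_real, Real.norm_eq_abs, abs_mul]
              have := mul_le_one₀ (abs_waveVec_le l a) (abs_nonneg _) (abs_waveVec_le l b)
              norm_num
              linarith
            · exact hAS l k hk
        _ = δ := one_mul δ
    rw [sum_const, card_univ, Fintype.card_fin, nsmul_eq_mul] at e2
    push_cast at e1 e2 ⊢
    refine (norm_sub_le_norm_sub_add_norm_sub _ _ _).trans ((add_le_add e1 e2).trans ?_)
    linarith

/-! ### The velocity increment -/

/-- The velocity increment is `∇^⊥ψ`; rotating by a right angle turns the averages of `∂ψ ⊗ ∂ψ` into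
those of `w ⊗ w`, so `ψ` is built for the cofactor matrix of `-R`. -/
theorem exists_increment {R : MField} (hR : ∀ i j, Continuous fun x => R x i j)
    (hsymm : ∀ x, (R x).IsSymm) :
    ∃ B : ℝ, ∀ ε > 0, ∀ S : Finset (Fin 2 → ℤ), ∀ J : ℕ, ∃ w : VField,
      (∀ i, IsTrig fun x => w x i) ∧ (∀ x, ∑ i, pd i (fun y => w y i) x = 0) ∧
      (∃ j, J ≤ j ∧ ∀ i k, coeff (fun x => w x i) k ≠ 0 → InShell j k) ∧
      (∀ i, ∫ x, |w x i| ∂μT ≤ ε) ∧ (∀ i, ∫ x, w x i ^ 2 ∂μT ≤ B) ∧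
      ∀ i j, ∀ k ∈ S, k ≠ 0 → ‖coeff (fun x => R x i j + w x i * w x j) k‖ ≤ ε := by
  let Q : Fin 2 → Fin 2 → T2 → ℝ :=
    ![![fun x => -R x 1 1, fun x => R x 0 1], ![fun x => R x 0 1, fun x => -R x 0 0]]
  have hQ : ∀ a b, Continuous (Q a b) := by
    have h00 := hR 0 0
    have h01 := hR 0 1
    have h11 := hR 1 1
    intro a b
    fin_cases a <;> fin_cases b <;> simp [Q] <;> fun_prop
  obtain ⟨B, hB⟩ := exists_stream hQ rfl
  refine ⟨B, fun ε hε S J => ?_⟩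
  obtain ⟨ψ, hψ, j, hj, hsh, h1, h2, hS⟩ := hB ε hε S J
  let w : VField := fun x => WithLp.toLp 2 ![-pd 1 ψ x, pd 0 ψ x]
  have w0 : (fun x => w x 0) = fun x => -pd 1 ψ x := rfl
  have w1 : (fun x => w x 1) = pd 0 ψ := rfl
  have hR10 : ∀ x, R x 1 0 = R x 0 1 := fun x => (hsymm x).apply 0 1
  refine ⟨w, ?_, ?_, ⟨j, hj, ?_⟩, ?_, ?_, ?_⟩
  · intro i; fin_cases i
    exacts [(hψ.pd 1).neg, hψ.pd 0]
  · intro x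
    rw [Fin.sum_univ_two, w0, w1, pd_neg, hψ.pd_comm 0 1, neg_add_cancel]
  · intro i k hk
    refine hsh k fun h0 => hk ?_
    fin_cases i
    · refine (coeff_neg (pd 1 ψ) k).trans ?_
      rw [hψ.coeff_pd, h0]; simp
    · refine (hψ.coeff_pd 0 k).trans ?_
      rw [h0]; simp
  · intro i; fin_cases i
    · simpa [w] using h1 1
    · exact h1 0
  · intro i; fin_cases i
    · simpa [w] using h2 1
    · exact h2 0
  · have hc : ∀ a b, Continuous fun x => pd a ψ x * pd b ψ x :=
      fun a b => ((hψ.pd a).mul (hψ.pd b)).continuous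
    intro i l k hk hk0
    fin_cases i <;> fin_cases l
    · refine le_of_eq_of_le (congrArg norm ?_) (hS 1 1 k hk hk0)
      rw [← coeff_sub (hc 1 1) (hQ 1 1)]
      congr 1; ext x; simp [w, Q]; ring
    · refine le_of_eq_of_le ?_ (hS 1 0 k hk hk0)
      rw [← coeff_sub (hc 1 0) (hQ 1 0), ← norm_neg, ← coeff_neg]
      congr 2; ext x; simp [w, Q]; ring
    · refine le_of_eq_of_le ?_ (hS 0 1 k hk hk0)
      rw [← coeff_sub (hc 0 1) (hQ 0 1), ← norm_neg, ← coeff_neg]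
      congr 2; ext x; simp [w, Q, hR10]; ring
    · refine le_of_eq_of_le (congrArg norm ?_) (hS 0 0 k hk hk0)
      rw [← coeff_sub (hc 0 0) (hQ 0 0)]
      congr 1; ext x; simp [w, Q]; ring

/-! ### Lebesgue norms -/

theorem continuous_of_components {u : VField} (hu : ∀ i, Continuous fun x => u x i) :
    Continuous u :=
  (PiLp.continuous_toLp 2 fun _ : Fin 2 => ℝ).comp (continuous_pi hu)

theorem lintegral_ofReal_le {f : T2 → ℝ} (hf : Continuous f) (h0 : ∀ x, 0 ≤ f x) {a : ℝ}
    (h : ∫ x, f x ∂μT ≤ a) : ∫⁻ x, ENNReal.ofReal (f x) ∂μT ≤ ENNReal.ofReal a := by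
  rw [← ofReal_integral_eq_lintegral_ofReal (integrable_of_continuous hf)
    (Filter.Eventually.of_forall h0)]
  exact ENNReal.ofReal_le_ofReal h

/-- By Hölder's inequality, a vector field bounded in `L²` and small in `L¹` is small in `Lᵖ` for
`1 < p < 2`. -/
theorem exists_LpNorm_lt (B : ℝ) {p η : ℝ} (hp1 : 1 < p) (hp2 : p < 2) (hη : 0 < η) :
    ∃ ε > 0, ∀ w : VField, (∀ i, Continuous fun x => w x i) → (∀ i, ∫ x, |w x i| ∂μT ≤ ε) →
      (∀ i, ∫ x, w x i ^ 2 ∂μT ≤ B) → LpNorm p w < ENNReal.ofReal η := by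
  set K := 2 * |B|
  have hK : 0 ≤ K := by positivity
  have hcont : Filter.Tendsto (fun t : ℝ => ((2 * t) ^ (2 - p) * K ^ (p - 1)) ^ (1 / p))
      (nhdsWithin 0 (Set.Ioi 0)) (nhds 0) := by
    have h1 : Continuous fun t : ℝ => ((2 * t) ^ (2 - p) * K ^ (p - 1)) ^ (1 / p) := by
      refine Continuous.rpow_const (((continuous_const.mul continuous_id).rpow_const
        fun x => Or.inr (by linarith)).mul continuous_const) fun x => Or.inr (by positivity)
    have h2 := (h1.tendsto 0).mono_left (nhdsWithin_le_nhds (s := Set.Ioi 0))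
    convert h2 using 2
    rw [mul_zero, Real.zero_rpow (by linarith), zero_mul, Real.zero_rpow (by positivity)]
  obtain ⟨ε, hlt, hε⟩ := ((hcont.eventually_lt_const hη).and self_mem_nhdsWithin).exists
  replace hε : 0 < ε := hε
  refine ⟨ε, hε, fun w hw h1 h2 => lt_of_le_of_lt ?_ ((ENNReal.ofReal_lt_ofReal_iff hη).mpr hlt)⟩
  have hwc := continuous_of_components hw
  have i1 : ∫⁻ x, ‖w x‖ₑ ∂μT ≤ ENNReal.ofReal (2 * ε) := by
    simp only [← ofReal_norm]
    refine lintegral_ofReal_le hwc.norm (fun _ => norm_nonneg _) ?_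
    calc ∫ x, ‖w x‖ ∂μT ≤ ∫ x, (|w x 0| + |w x 1|) ∂μT := by
          refine integral_mono (integrable_of_continuous hwc.norm)
            (integrable_of_continuous ((hw 0).abs.add (hw 1).abs)) fun x => ?_
          simp only
          rw [EuclideanSpace.norm_eq, Fin.sum_univ_two, Real.sqrt_le_left (by positivity)]
          simp only [Real.norm_eq_abs]
          nlinarith [abs_nonneg (w x 0), abs_nonneg (w x 1)]
      _ ≤ 2 * ε := by
          rw [integral_add (integrable_of_continuous (hw 0).abs)
            (integrable_of_continuous (hw 1).abs)]
          linarith [h1 0, h1 1]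
  have i2 : ∫⁻ x, ‖w x‖ₑ ^ (2 : ℝ) ∂μT ≤ ENNReal.ofReal K := by
    have e : ∀ x, ‖w x‖ₑ ^ (2 : ℝ) = ENNReal.ofReal (w x 0 ^ 2 + w x 1 ^ 2) := fun x => by
      rw [← ofReal_norm, ENNReal.ofReal_rpow_of_nonneg (norm_nonneg _) (by norm_num)]
      congr 1
      rw [Real.rpow_ofNat, EuclideanSpace.norm_sq_eq, Fin.sum_univ_two]
      simp
    simp only [e]
    refine lintegral_ofReal_le (f := fun x => w x 0 ^ 2 + w x 1 ^ 2)
      (((hw 0).pow 2).add ((hw 1).pow 2)) (fun _ => by positivity) ?_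
    rw [integral_add (f := fun x => w x 0 ^ 2) (g := fun x => w x 1 ^ 2)
      (integrable_of_continuous ((hw 0).pow 2)) (integrable_of_continuous ((hw 1).pow 2))]
    linarith [h2 0, h2 1, le_abs_self B]
  rw [LpNorm, eLpNorm_eq_lintegral_rpow_enorm_toReal (by simpa using by linarith)
    ENNReal.ofReal_ne_top, ENNReal.toReal_ofReal (by linarith),
    ← ENNReal.ofReal_rpow_of_nonneg (by positivity) (by positivity),
    ENNReal.ofReal_mul (by positivity),
    ← ENNReal.ofReal_rpow_of_nonneg (by positivity) (by linarith),
    ← ENNReal.ofReal_rpow_of_nonneg hK (by linarith)]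
  gcongr
  -- the exponents `2 - p` and `p - 1` add up to `1`
  have e : ∀ x, ‖w x‖ₑ ^ p = ‖w x‖ₑ ^ (2 - p) * (‖w x‖ₑ ^ (2 : ℝ)) ^ (p - 1) := fun x => by
    rw [← ENNReal.rpow_mul, ← ENNReal.rpow_add_of_nonneg _ _ (by linarith) (by linarith)]
    congr 1; ring
  simp only [e]
  have hm : Measurable fun x => ‖w x‖ₑ := hwc.enorm.measurable
  refine (ENNReal.lintegral_mul_norm_pow_le hm.aemeasurable (hm.pow_const _).aemeasurable
    (by linarith) (by linarith) (by ring)).trans ?_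
  gcongr

theorem L1NormM_outer_comm (u v : VField) : L1NormM (outer v u) = L1NormM (outer u v) := by
  unfold L1NormM outer
  congr 1; ext x
  rw [sum_comm]
  simp [mul_comm]

theorem sqrt_sum_outer_sq_le {u v : VField} {M : ℝ} (x : T2) (hM : ∀ i, |u x i| ≤ M) :
    Real.sqrt (∑ i, ∑ j, outer u v x i j ^ 2) ≤ 2 * M * (|v x 0| + |v x 1|) := by
  have hM0 : 0 ≤ M := (abs_nonneg _).trans (hM 0)
  rw [Real.sqrt_le_left (by positivity)]
  simp only [Fin.sum_univ_two, outer, Matrix.of_apply, mul_pow]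
  have a0 : u x 0 ^ 2 ≤ M ^ 2 := sq_le_sq' (abs_le.mp (hM 0)).1 (abs_le.mp (hM 0)).2
  have a1 : u x 1 ^ 2 ≤ M ^ 2 := sq_le_sq' (abs_le.mp (hM 1)).1 (abs_le.mp (hM 1)).2
  have b : v x 0 ^ 2 + v x 1 ^ 2 ≤ (|v x 0| + |v x 1|) ^ 2 := by
    rw [← sq_abs (v x 0), ← sq_abs (v x 1)]
    nlinarith [abs_nonneg (v x 0), abs_nonneg (v x 1)]
  calc _ = (u x 0 ^ 2 + u x 1 ^ 2) * (v x 0 ^ 2 + v x 1 ^ 2) := by ring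
    _ ≤ (M ^ 2 + M ^ 2) * (|v x 0| + |v x 1|) ^ 2 := by gcongr
    _ ≤ 2 ^ 2 * M ^ 2 * (|v x 0| + |v x 1|) ^ 2 := by gcongr; linarith [sq_nonneg M]

theorem L1NormM_outer_le {u v : VField} (hv : ∀ i, Continuous fun x => v x i) {M ε : ℝ}
    (hM : ∀ x i, |u x i| ≤ M) (hε : ∀ i, ∫ x, |v x i| ∂μT ≤ ε) :
    L1NormM (outer u v) ≤ ENNReal.ofReal (4 * (M * ε)) := by
  have hM0 : 0 ≤ M := (abs_nonneg _).trans (hM 0 0)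
  refine (lintegral_mono fun x => ENNReal.ofReal_le_ofReal
    (sqrt_sum_outer_sq_le x (hM x))).trans ?_
  refine lintegral_ofReal_le (f := fun x => 2 * M * (|v x 0| + |v x 1|))
    (continuous_const.mul ((hv 0).abs.add (hv 1).abs))
    (fun _ => by positivity) ?_
  rw [integral_const_mul, integral_add (integrable_of_continuous (hv 0).abs)
    (integrable_of_continuous (hv 1).abs)]
  calc _ ≤ 2 * M * (ε + ε) := by gcongr <;> apply hε
    _ = _ := by ring

/-! ### The norm of `H^{-2}` -/

/-- The square of the `Ḣ^{-2}` norm of a matrix field. -/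
def hsq (X : MField) : ℝ≥0∞ :=
  ∑' k : Fin 2 → ℤ, if k = 0 then 0 else
    ENNReal.ofReal (‖freq k‖ ^ ((2 : ℝ) * (-2)) * ∑ i, ∑ j, ‖coeff (fun x => X x i j) k‖ ^ 2)

theorem HNormM_lt_iff (X : MField) {r : ℝ} (hr : 0 ≤ r) :
    HNormM (-2) X < ENNReal.ofReal r ↔ hsq X < ENNReal.ofReal (r ^ 2) := by
  have h : HNormM (-2) X = hsq X ^ (1 / 2 : ℝ) := rfl
  rw [h, one_div, ENNReal.rpow_inv_lt_iff (by norm_num), ENNReal.ofReal_pow hr,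
    ENNReal.rpow_ofNat]

theorem hsq_le_of_coeff_le {X Y Z : MField}
    (h : ∀ i j k, k ≠ 0 → ‖coeff (fun x => Z x i j) k‖
      ≤ ‖coeff (fun x => X x i j) k‖ + ‖coeff (fun x => Y x i j) k‖) :
    hsq Z ≤ 2 * (hsq X + hsq Y) := by
  unfold hsq
  rw [← ENNReal.tsum_add, ← ENNReal.tsum_mul_left]
  refine ENNReal.tsum_le_tsum fun k => ?_
  split_ifs with hk
  · simp
  · have two : ∀ y : ℝ, 2 * ENNReal.ofReal y = ENNReal.ofReal (2 * y) := fun y => by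
      rw [ENNReal.ofReal_mul (by norm_num), ENNReal.ofReal_ofNat]
    rw [← ENNReal.ofReal_add (by positivity) (by positivity), two, ← mul_add,
      mul_left_comm, ← sum_add_distrib, mul_sum _ _ (2 : ℝ)]
    refine ENNReal.ofReal_le_ofReal (mul_le_mul_of_nonneg_left (sum_le_sum fun i _ => ?_)
      (by positivity))
    rw [← sum_add_distrib, mul_sum]
    refine sum_le_sum fun j _ => ?_
    calc _ ≤ (‖coeff (fun x => X x i j) k‖ + ‖coeff (fun x => Y x i j) k‖) ^ 2 := by
          gcongr; exact h i j k hk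
      _ ≤ _ := add_sq_le

theorem norm_le_norm_freq (k : Fin 2 → ℤ) : ‖k‖ ≤ ‖freq k‖ := by
  refine (pi_norm_le_iff_of_nonneg (norm_nonneg _)).mpr fun i => ?_
  have := PiLp.norm_apply_le (freq k) i
  simpa [freq, Int.norm_eq_abs] using this

theorem abs_le_norm_freq (k : Fin 2 → ℤ) (i : Fin 2) : |(k i : ℝ)| ≤ ‖freq k‖ := by
  have := PiLp.norm_apply_le (freq k) i
  simpa [freq] using this

theorem one_le_norm_freq {k : Fin 2 → ℤ} (hk : k ≠ 0) : 1 ≤ ‖freq k‖ := by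
  obtain ⟨i, hi⟩ := Function.ne_iff.mp hk
  refine le_trans ?_ (abs_le_norm_freq k i)
  have : 1 ≤ |k i| := Int.one_le_abs hi
  exact_mod_cast this

theorem summable_norm_freq : Summable fun k : Fin 2 → ℤ => ‖freq k‖ ^ ((2 : ℝ) * (-2)) := by
  have h := EisensteinSeries.summable_one_div_norm_rpow (k := 4) (by norm_num)
  refine h.of_nonneg_of_le (fun k => by positivity) fun k => ?_
  by_cases hk : k = 0
  · subst hk
    rw [show freq 0 = 0 by ext i; simp [freq]]
    norm_num
  · rw [show (2 : ℝ) * (-2) = -4 by norm_num]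
    exact Real.rpow_le_rpow_of_nonpos (norm_pos_iff.mpr hk) (norm_le_norm_freq k) (by norm_num)

/-- Boundedness of all Fourier coefficients and smallness of finitely many of them imply smallness
in `Ḣ^{-2}`, because `∑ |k|⁻⁴` converges in two dimensions. -/
theorem exists_hsq_le (B : ℝ) {δ : ℝ} (hδ : 0 < δ) : ∃ S : Finset (Fin 2 → ℤ), ∃ ε > 0,
    ∀ X : MField, (∀ i j k, ‖coeff (fun x => X x i j) k‖ ≤ B) →
      (∀ i j, ∀ k ∈ S, k ≠ 0 → ‖coeff (fun x => X x i j) k‖ ≤ ε) → hsq X ≤ ENNReal.ofReal δ := by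
  set a : (Fin 2 → ℤ) → ℝ := fun k => ‖freq k‖ ^ ((2 : ℝ) * (-2))
  have ha0 : ∀ k, 0 ≤ a k := fun k => by positivity
  have ha : Summable a := summable_norm_freq
  have htail := (tendsto_tsum_compl_atTop_zero a).eventually_lt_const
    (show (0 : ℝ) < δ / (2 * (4 * B ^ 2 + 1)) by positivity)
  obtain ⟨S, hS⟩ := htail.exists
  set Z := ∑ k ∈ S, a k
  have hZ : 0 ≤ Z := sum_nonneg fun k _ => ha0 k
  refine ⟨S, Real.sqrt (δ / (2 * (4 * Z + 1))), by positivity, fun X hB hX => ?_⟩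
  set ε := Real.sqrt (δ / (2 * (4 * Z + 1)))
  have hε : ε ^ 2 = δ / (2 * (4 * Z + 1)) := Real.sq_sqrt (by positivity)
  have hterm : ∀ (k : Fin 2 → ℤ) (b : ℝ), (∀ i j, ‖coeff (fun x => X x i j) k‖ ≤ b) →
      a k * ∑ i, ∑ j, ‖coeff (fun x => X x i j) k‖ ^ 2 ≤ 4 * b ^ 2 * a k := fun k b hb => by
    have : ∑ i, ∑ j, ‖coeff (fun x => X x i j) k‖ ^ 2 ≤ ∑ _i : Fin 2, ∑ _j : Fin 2, b ^ 2 :=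
      sum_le_sum fun i _ => sum_le_sum fun j _ => by gcongr; exact hb i j
    simp only [sum_const, card_univ, Fintype.card_fin, nsmul_eq_mul] at this
    push_cast at this
    nlinarith [ha0 k]
  unfold hsq
  rw [← ENNReal.sum_add_tsum_compl S]
  have p1 : ∑ k ∈ S, (if k = 0 then 0 else
      ENNReal.ofReal (a k * ∑ i, ∑ j, ‖coeff (fun x => X x i j) k‖ ^ 2))
      ≤ ENNReal.ofReal (4 * ε ^ 2 * Z) := by
    rw [mul_sum, ENNReal.ofReal_sum_of_nonneg fun k _ => mul_nonneg (by positivity) (ha0 k)]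
    refine sum_le_sum fun k hk => ?_
    split_ifs with hk0
    · exact zero_le
    · exact ENNReal.ofReal_le_ofReal (hterm k ε fun i j => hX i j k hk hk0)
  have p2 : ∑' k : ↥((S : Set (Fin 2 → ℤ))ᶜ), (if (k : Fin 2 → ℤ) = 0 then 0 else
      ENNReal.ofReal (a k * ∑ i, ∑ j, ‖coeff (fun x => X x i j) k‖ ^ 2))
      ≤ ENNReal.ofReal (4 * B ^ 2 * (δ / (2 * (4 * B ^ 2 + 1)))) := by
    have hsum : Summable fun k : ↥((S : Set (Fin 2 → ℤ))ᶜ) => 4 * B ^ 2 * a k :=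
      (ha.subtype _).mul_left _
    calc _ ≤ ∑' k : ↥((S : Set (Fin 2 → ℤ))ᶜ), ENNReal.ofReal (4 * B ^ 2 * a k) := by
          refine ENNReal.tsum_le_tsum fun k => ?_
          split_ifs with hk0
          · exact zero_le
          · exact ENNReal.ofReal_le_ofReal (hterm k B fun i j => hB i j k)
      _ = ENNReal.ofReal (∑' k : ↥((S : Set (Fin 2 → ℤ))ᶜ), 4 * B ^ 2 * a k) :=
          (ENNReal.ofReal_tsum_of_nonneg (fun k => mul_nonneg (by positivity) (ha0 _)) hsum).symm
      _ ≤ _ := by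
          rw [tsum_mul_left]
          refine ENNReal.ofReal_le_ofReal (mul_le_mul_of_nonneg_left hS.le (by positivity))
  refine (add_le_add p1 p2).trans ?_
  rw [← ENNReal.ofReal_add (by positivity) (by positivity), hε]
  refine ENNReal.ofReal_le_ofReal ?_
  have e1 : 4 * (δ / (2 * (4 * Z + 1))) * Z ≤ δ / 2 := by
    rw [mul_div_assoc', div_mul_eq_mul_div, div_le_div_iff₀ (by positivity) (by positivity)]
    nlinarith
  have e2 : 4 * B ^ 2 * (δ / (2 * (4 * B ^ 2 + 1))) ≤ δ / 2 := by
    rw [mul_div_assoc', div_le_div_iff₀ (by positivity) (by positivity)]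
    nlinarith
  linarith

/-- A field with frequencies in one shell and coefficients bounded by `K |k|` has `Ḣ^{-2}` norm at
most `10 K`, uniformly in the shell: the `j`-th shell has at most `25 · 4ʲ` frequencies. -/
theorem hsq_le_of_inShell {X : MField} {j : ℕ} {K : ℝ}
    (hX : ∀ a b k, coeff (fun x => X x a b) k ≠ 0 → InShell j k)
    (hb : ∀ a b k, ‖coeff (fun x => X x a b) k‖ ≤ K * ‖freq k‖) :
    hsq X ≤ ENNReal.ofReal (100 * K ^ 2) := by
  set n : ℕ := 2 * 2 ^ j
  set box : Finset (Fin 2 → ℤ) := Finset.Icc (fun _ => -(n : ℤ)) (fun _ => (n : ℤ))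
  have hcard : (box.card : ℝ) ≤ 25 * (2 ^ j) ^ 2 := by
    have h1 : box.card = (2 * n + 1) ^ 2 := by
      rw [Pi.card_Icc]
      simp only [Int.card_Icc, prod_const, card_univ, Fintype.card_fin]
      congr 1; omega
    have h2 : (1 : ℝ) ≤ 2 ^ j := one_le_pow₀ one_le_two
    rw [h1]
    push_cast [n]
    nlinarith
  have hout : ∀ k ∉ box, ∀ a b, coeff (fun x => X x a b) k = 0 := fun k hk a b => by
    by_contra h0
    have h1 := (hX a b k h0).2
    refine hk ?_
    have h3 : ∀ i, |k i| ≤ n := fun i => by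
      have h2 := (abs_le_norm_freq k i).trans h1
      have h4 : |(k i : ℝ)| ≤ (n : ℝ) := by
        refine h2.trans ?_
        push_cast [n]
        gcongr
        norm_num
      exact_mod_cast h4
    rw [Finset.mem_Icc]
    exact ⟨fun i => (abs_le.mp (h3 i)).1, fun i => (abs_le.mp (h3 i)).2⟩
  have hterm : ∀ k, k ≠ 0 → ‖freq k‖ ^ ((2 : ℝ) * (-2)) *
      ∑ a, ∑ b, ‖coeff (fun x => X x a b) k‖ ^ 2 ≤ 4 * K ^ 2 / (2 ^ j) ^ 2 := fun k hk => by
    by_cases hz : ∀ a b, coeff (fun x => X x a b) k = 0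
    · simp only [hz]; simp; positivity
    push Not at hz
    obtain ⟨a, b, hab⟩ := hz
    have h1 := (hX a b k hab).1
    have hpos : 0 < ‖freq k‖ := by linarith [one_le_norm_freq hk]
    have h2 : ∑ a, ∑ b, ‖coeff (fun x => X x a b) k‖ ^ 2
        ≤ ∑ _a : Fin 2, ∑ _b : Fin 2, (K * ‖freq k‖) ^ 2 :=
      sum_le_sum fun i _ => sum_le_sum fun j _ => by gcongr; exact hb i j k
    have h3 : ‖freq k‖ ^ ((2 : ℝ) * (-2)) = (‖freq k‖ ^ 4)⁻¹ := by
      rw [show (2 : ℝ) * (-2) = -((4 : ℕ) : ℝ) by norm_num, Real.rpow_neg hpos.le,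
        Real.rpow_natCast]
    calc _ ≤ (‖freq k‖ ^ 4)⁻¹ * ∑ _a : Fin 2, ∑ _b : Fin 2, (K * ‖freq k‖) ^ 2 := by
          rw [h3]; gcongr
      _ = 4 * K ^ 2 / ‖freq k‖ ^ 2 := by
          simp only [sum_const, card_univ, Fintype.card_fin, nsmul_eq_mul]
          push_cast
          field_simp
          ring
      _ ≤ _ := by gcongr
  unfold hsq
  rw [tsum_eq_sum (s := box) fun k hk => by simp [hout k hk]]
  calc _ ≤ ∑ _k ∈ box, ENNReal.ofReal (4 * K ^ 2 / (2 ^ j) ^ 2) := by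
        refine sum_le_sum fun k _ => ?_
        split_ifs with hk
        · exact zero_le
        · exact ENNReal.ofReal_le_ofReal (hterm k hk)
    _ = ENNReal.ofReal (box.card * (4 * K ^ 2 / (2 ^ j) ^ 2)) := by
        rw [sum_const, nsmul_eq_mul, ENNReal.ofReal_mul (by positivity), ENNReal.ofReal_natCast]
    _ ≤ _ := by
        refine ENNReal.ofReal_le_ofReal ?_
        calc _ ≤ 25 * (2 ^ j) ^ 2 * (4 * K ^ 2 / (2 ^ j) ^ 2) := by gcongr
          _ = _ := by field_simp; ring

/-! ### The new stress -/

theorem Smooth.pd {f : T2 → ℝ} (hf : Smooth f) (i : Fin 2) : Smooth (pd i f) := by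
  set F : (Fin 2 → ℝ) → ℝ := fun y => f fun i => (y i : UnitAddCircle) with hF
  have h : (fun y : Fin 2 → ℝ => StationaryNS.pd i f fun i => (y i : UnitAddCircle))
      = fun y => fderiv ℝ F y (Pi.single i 1) := by
    ext y
    have h1 : (fun t : ℝ => f ((fun j => (y j : UnitAddCircle)) + Pi.single i (t : UnitAddCircle)))
        = F ∘ fun t : ℝ => y + t • Pi.single i 1 := by
      ext t
      refine congrArg f (funext fun j => ?_)
      by_cases hj : j = i
      · subst hj; simp
      · simp [hj]
    have h2 : HasDerivAt (fun t : ℝ => y + t • (Pi.single i 1 : Fin 2 → ℝ)) (Pi.single i 1) 0 := by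
      simpa using ((hasDerivAt_id (0 : ℝ)).smul_const (Pi.single i 1 : Fin 2 → ℝ)).const_add y
    have h3 : HasFDerivAt F (fderiv ℝ F y) (y + (0 : ℝ) • Pi.single i 1) := by
      rw [zero_smul, add_zero]
      exact ((ContDiff.differentiable hf (by simp)) y).hasFDerivAt
    have := (h3.comp_hasDerivAt (0 : ℝ) h2).deriv
    rw [← h1] at this
    exact this
  rw [Smooth, h]
  exact (ContDiff.fderiv_right (m := ∞) hf (by simp)).clm_apply contDiff_const

/-- The stress created by adding the increment `w` to the velocity `u` with stress `R`, before its
mean is removed; `Δw` is written as the divergence of the symmetrised gradient of `w`. -/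
def stressSum (u w : VField) (R : MField) : MField := fun x => Matrix.of fun i j =>
  R x i j + w x i * w x j + (u x i * w x j + w x i * u x j)
    - (pd i (fun y => w y j) x + pd j (fun y => w y i) x)

theorem coeff_removeMean {X : MField} (hX : ∀ i j, Continuous fun x => X x i j) (i j : Fin 2)
    {k : Fin 2 → ℤ} (hk : k ≠ 0) :
    coeff (fun x => removeMean X x i j) k = coeff (fun x => X x i j) k := by
  refine (coeff_sub (g := fun _ => ∫ y, X y i j ∂μT) (hX i j) continuous_const k).trans ?_
  rw [coeff_const _ hk, sub_zero]

theorem meanZeroM_removeMean {X : MField} (hX : ∀ i j, Continuous fun x => X x i j) :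
    MeanZeroM (removeMean X) := fun i j => by
  refine (integral_sub (g := fun _ => ∫ y, X y i j ∂μT) (integrable_of_continuous (hX i j))
    (integrable_const _)).trans ?_
  simp

section
variable {u w : VField} {R : MField}

theorem smoothM_stressSum (hu : SmoothV u) (hw : SmoothV w) (hR : SmoothM R) :
    SmoothM (stressSum u w R) := fun i j =>
  (((hR i j).add ((hw i).mul (hw j))).add (((hu i).mul (hw j)).add ((hw i).mul (hu j)))).sub
    (((hw j).pd i).add ((hw i).pd j))

theorem smoothM_removeMean (hR : SmoothM R) : SmoothM (removeMean R) := fun i j =>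
  (hR i j).sub (.const _)

/-- The pressure is unchanged. The gradient `∇(div w)` in the divergence of the symmetrised gradient
vanishes. -/
theorem SolvesNSR.add_increment (h : SolvesNSR u R) (hu : SmoothV u) (hR : SmoothM R)
    (hw : ∀ i, IsTrig fun x => w x i) (hdiv : ∀ x, ∑ i, pd i (fun y => w y i) x = 0) :
    SolvesNSR (u + w) (removeMean (stressSum u w R)) := by
  obtain ⟨hs, ⟨p, hp, hmom⟩, hdu⟩ := h
  have hws : SmoothV w := fun i => (hw i).smooth
  refine ⟨fun x => ?_, ⟨p, hp, fun x i => ?_⟩, fun x => ?_⟩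
  · have hsum : ∀ y i j, stressSum u w R y i j = stressSum u w R y j i := fun y i j => by
      have := (hs y).apply i j
      simp only [stressSum, Matrix.of_apply]
      rw [this]; ring
    refine Matrix.IsSymm.ext fun i j => ?_
    simp only [removeMean, Matrix.of_apply]
    simp only [hsum _ j i]
  · have hgrad : ∑ j, pd j (pd i fun y => w y j) x = 0 := by
      calc _ = ∑ j, pd i (pd j fun y => w y j) x :=
            sum_congr rfl fun j _ => (hw j).pd_comm j i x
        _ = pd i (fun y => ∑ j, pd j (fun y => w y j) y) x :=
            (pd_sum _ (fun j _ => (hws j).pd j) i x).symm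
        _ = 0 := by simp only [hdiv, pd_const]
    have e1 : ∀ j, pd j (fun y => outer (u + w) (u + w) y i j) x = pd j (fun y => outer u u y i j) x
        + pd j (fun y => w y i * w y j + (u y i * w y j + w y i * u y j)) x := fun j => by
      have s1 : Smooth fun y => outer u u y i j := (hu i).mul (hu j)
      have s2 : Smooth fun y => w y i * w y j + (u y i * w y j + w y i * u y j) :=
        ((hws i).mul (hws j)).add (((hu i).mul (hws j)).add ((hws i).mul (hu j)))
      rw [← s1.pd_add s2]
      congr 1; ext y
      simp only [outer, Matrix.of_apply, Pi.add_apply, PiLp.add_apply]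
      ring
    have e2 : ∀ j, pd j (pd j fun y => (u + w) y i) x
        = pd j (pd j fun y => u y i) x + pd j (pd j fun y => w y i) x := fun j => by
      rw [← ((hu i).pd j).pd_add ((hws i).pd j)]
      congr 1; ext y
      exact (hu i).pd_add (hws i) j y
    have e3 : ∀ j, pd j (fun y => removeMean (stressSum u w R) y i j) x
        = pd j (fun y => R y i j) x
          + pd j (fun y => w y i * w y j + (u y i * w y j + w y i * u y j)) x
          - (pd j (pd i fun y => w y j) x + pd j (pd j fun y => w y i) x) := fun j => by
      have s2 : Smooth fun y => w y i * w y j + (u y i * w y j + w y i * u y j) :=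
        ((hws i).mul (hws j)).add (((hu i).mul (hws j)).add ((hws i).mul (hu j)))
      have s3 := ((hws j).pd i).add ((hws i).pd j)
      have key := (((hR i j).add s2).sub s3).pd_sub
        (.const (∫ y, stressSum u w R y i j ∂μT)) j x
      rw [pd_const, sub_zero, ((hR i j).add s2).pd_sub s3, (hR i j).pd_add s2,
        ((hws j).pd i).pd_add ((hws i).pd j)] at key
      rw [← key]
      congr 1; ext y
      simp only [removeMean, stressSum, Matrix.of_apply]
      ring
    simp only [e1, e2, e3, sum_add_distrib, sum_sub_distrib, hgrad, ← hmom x i]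
    ring
  · have e : ∀ i, pd i (fun y => (u + w) y i) x
        = pd i (fun y => u y i) x + pd i (fun y => w y i) x := fun i =>
      (hu i).pd_add (hws i) i x
    simp only [e, sum_add_distrib, hdu, hdiv, add_zero]

theorem norm_coeff_mul_le_of_sq {f g : T2 → ℝ} (hf : Continuous f) (hg : Continuous g) {B : ℝ}
    (h1 : ∫ x, f x ^ 2 ∂μT ≤ B) (h2 : ∫ x, g x ^ 2 ∂μT ≤ B) (k : Fin 2 → ℤ) :
    ‖coeff (fun x => f x * g x) k‖ ≤ B := by
  refine (norm_coeff_le _ k).trans ?_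
  calc _ ≤ ∫ x, (f x ^ 2 + g x ^ 2) / 2 ∂μT := by
        refine integral_mono (integrable_of_continuous (by fun_prop))
          (integrable_of_continuous (by fun_prop)) fun x => ?_
        simp only [abs_mul]
        rw [← sq_abs (f x), ← sq_abs (g x)]
        nlinarith [sq_nonneg (|f x| - |g x|)]
    _ ≤ B := by
        rw [integral_div, integral_add (integrable_of_continuous (by fun_prop))
          (integrable_of_continuous (by fun_prop))]
        linarith

theorem norm_coeff_mul_le_of_bound {f g : T2 → ℝ} (hf : Continuous f) (hg : Continuous g)
    {M ε : ℝ} (h1 : ∀ x, |f x| ≤ M) (h2 : ∫ x, |g x| ∂μT ≤ ε) (k : Fin 2 → ℤ) :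
    ‖coeff (fun x => f x * g x) k‖ ≤ M * ε := by
  have hM0 : 0 ≤ M := (abs_nonneg _).trans (h1 0)
  refine (norm_coeff_le _ k).trans ?_
  calc _ ≤ ∫ x, M * |g x| ∂μT := by
        refine integral_mono (integrable_of_continuous (by fun_prop))
          (integrable_of_continuous (by fun_prop)) fun x => ?_
        simp only [abs_mul]
        gcongr
        exact h1 x
    _ ≤ M * ε := by rw [integral_const_mul]; gcongr

/-- The linear part `∇w + (∇w)ᵀ` of the new stress. -/
theorem hsq_symmGrad_le {j : ℕ} {ε : ℝ} (hw : ∀ i, IsTrig fun x => w x i)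
    (hsh : ∀ i k, coeff (fun x => w x i) k ≠ 0 → InShell j k) (h1 : ∀ i, ∫ x, |w x i| ∂μT ≤ ε) :
    hsq (fun x => Matrix.of fun i j => pd i (fun y => w y j) x + pd j (fun y => w y i) x)
      ≤ ENNReal.ofReal (100 * (13 * ε) ^ 2) := by
  have hc : ∀ a b k, coeff (fun x => pd a (fun y => w y b) x + pd b (fun y => w y a) x) k
      = 2 * Real.pi * Complex.I * k a * coeff (fun x => w x b) k
        + 2 * Real.pi * Complex.I * k b * coeff (fun x => w x a) k := fun a b k => by
    rw [coeff_add ((hw b).pd a).continuous ((hw a).pd b).continuous, (hw b).coeff_pd,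
      (hw a).coeff_pd]
  have hε : 0 ≤ ε := (integral_nonneg fun x => abs_nonneg _).trans (h1 0)
  have hn : ∀ a b k, ‖2 * Real.pi * Complex.I * k a * coeff (fun x => w x b) k‖
      ≤ 2 * Real.pi * ‖freq k‖ * ε := fun a b k => by
    have e : ‖(2 * Real.pi * Complex.I * k a : ℂ)‖ = 2 * Real.pi * |(k a : ℝ)| := by
      simp [abs_of_pos Real.pi_pos]
    rw [norm_mul, e]
    have := Real.pi_pos
    gcongr
    exacts [abs_le_norm_freq k a, (norm_coeff_le _ k).trans (h1 b)]
  refine hsq_le_of_inShell (j := j) (fun a b k hk => ?_) fun a b k => ?_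
  · simp only [Matrix.of_apply] at hk
    by_contra hcon
    refine hk ?_
    have ha : ∀ a, coeff (fun x => w x a) k = 0 := fun a => by
      by_contra h0
      exact hcon (hsh a k h0)
    rw [hc, ha, ha]; simp
  · simp only [Matrix.of_apply]
    rw [hc]
    refine (norm_add_le _ _).trans ((add_le_add (hn a b k) (hn b a k)).trans ?_)
    have h4 : 2 * Real.pi + 2 * Real.pi ≤ 13 := by linarith [Real.pi_lt_d2]
    calc _ = (2 * Real.pi + 2 * Real.pi) * (‖freq k‖ * ε) := by ring
      _ ≤ 13 * (‖freq k‖ * ε) := by gcongr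
      _ = _ := by ring

end

theorem exists_hsq_stress_le {u : VField} {R : MField} (hu : ∀ i, Continuous fun x => u x i)
    (hR : ∀ i j, Continuous fun x => R x i j) (B : ℝ) {δ : ℝ} (hδ : 0 < δ) :
    ∃ S : Finset (Fin 2 → ℤ), ∃ ε₀ > 0, ∀ ε ≤ ε₀, ∀ (w : VField) (j : ℕ),
      (∀ i, IsTrig fun x => w x i) →
      (∀ i k, coeff (fun x => w x i) k ≠ 0 → InShell j k) → (∀ i, ∫ x, |w x i| ∂μT ≤ ε) →
      (∀ i, ∫ x, w x i ^ 2 ∂μT ≤ B) →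
      (∀ i j, ∀ k ∈ S, k ≠ 0 → ‖coeff (fun x => R x i j + w x i * w x j) k‖ ≤ ε) →
      hsq (fun x => Matrix.of fun i j => R x i j + w x i * w x j) ≤ ENNReal.ofReal δ ∧
      hsq (removeMean (stressSum u w R)) ≤ ENNReal.ofReal δ := by
  choose MR hMR using fun i j => exists_bound_of_continuous (hR i j)
  choose Mu hMu using fun i => exists_bound_of_continuous (hu i)
  have hMR0 : ∀ i j, 0 ≤ MR i j := fun i j => (abs_nonneg _).trans (hMR i j 0)
  have hMu0 : ∀ i, 0 ≤ Mu i := fun i => (abs_nonneg _).trans (hMu i 0)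
  set M₁ := ∑ i, ∑ j, MR i j
  set M₂ := ∑ i, Mu i
  have hM₁ : ∀ i j, MR i j ≤ M₁ := fun i j =>
    (single_le_sum (fun j _ => hMR0 i j) (mem_univ j)).trans
      (single_le_sum (f := fun i => ∑ j, MR i j) (fun i _ => sum_nonneg fun j _ => hMR0 i j)
        (mem_univ i))
  have hM₂ : ∀ i x, |u x i| ≤ M₂ := fun i x =>
    (hMu i x).trans (single_le_sum (fun i _ => hMu0 i) (mem_univ i))
  have hM₂0 : 0 ≤ M₂ := sum_nonneg fun i _ => hMu0 i
  obtain ⟨S, ε₁, hε₁, hS⟩ := exists_hsq_le (M₁ + B + 2 * M₂) (δ := δ / 4) (by positivity)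
  refine ⟨S, min (min 1 (ε₁ / (1 + 2 * M₂))) (Real.sqrt δ / 300), by positivity,
    fun ε hεle w j hw hsh h1 h2 hlow => ?_⟩
  have hε0 : 0 ≤ ε := (integral_nonneg fun x => abs_nonneg _).trans (h1 0)
  have hε1 : ε ≤ 1 := hεle.trans ((min_le_left _ _).trans (min_le_left _ _))
  have hε2 : ε * (1 + 2 * M₂) ≤ ε₁ := by
    rw [← le_div_iff₀ (by positivity)]
    exact hεle.trans ((min_le_left _ _).trans (min_le_right _ _))
  have hε3 : ε ≤ Real.sqrt δ / 300 := hεle.trans (min_le_right _ _)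
  have hwc : ∀ i, Continuous fun x => w x i := fun i => (hw i).continuous
  have c1 : ∀ i j, Continuous fun x => w x i * w x j := fun i j => (hwc i).mul (hwc j)
  have c2 : ∀ i j, Continuous fun x => u x i * w x j := fun i j => (hu i).mul (hwc j)
  have c3 : ∀ i j, Continuous fun x => w x i * u x j := fun i j => (hwc i).mul (hu j)
  have cww : ∀ i j, Continuous fun x => R x i j + w x i * w x j := fun i j =>
    (hR i j).add (c1 i j)
  have cuw : ∀ i j, Continuous fun x => u x i * w x j + w x i * u x j := fun i j =>
    (c2 i j).add (c3 i j)
  have bww : ∀ i j k, ‖coeff (fun x => R x i j + w x i * w x j) k‖ ≤ M₁ + B := fun i j k => by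
    rw [coeff_add (hR i j) (c1 i j)]
    exact (norm_add_le _ _).trans (add_le_add
      ((norm_coeff_le_of_bound (hMR i j) k).trans (hM₁ i j))
      (norm_coeff_mul_le_of_sq (hwc i) (hwc j) (h2 i) (h2 j) k))
  have buw : ∀ i j k, ‖coeff (fun x => u x i * w x j + w x i * u x j) k‖ ≤ 2 * M₂ * ε :=
    fun i j k => by
      rw [coeff_add (c2 i j) (c3 i j)]
      refine (norm_add_le _ _).trans ?_
      have e1 := norm_coeff_mul_le_of_bound (hu i) (hwc j) (hM₂ i) (h1 j) k
      have e2 := norm_coeff_mul_le_of_bound (hu j) (hwc i) (hM₂ j) (h1 i) k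
      simp only [mul_comm (u _ j)] at e2
      linarith
  have hδ4 : δ / 4 ≤ δ := by linarith
  constructor
  · refine (hS _ (fun i j k => ?_) fun i j k hk hk0 => ?_).trans (ENNReal.ofReal_le_ofReal hδ4)
    · exact (bww i j k).trans (by linarith)
    · refine (hlow i j k hk hk0).trans (le_trans ?_ hε2)
      nlinarith
  · set X : MField := fun x => Matrix.of fun i j =>
      R x i j + w x i * w x j + (u x i * w x j + w x i * u x j)
    set Y : MField := fun x => Matrix.of fun i j =>
      pd i (fun y => w y j) x + pd j (fun y => w y i) x
    have hX : hsq X ≤ ENNReal.ofReal (δ / 4) := by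
      have hcX : ∀ i j k, coeff (fun x => X x i j) k = coeff (fun x => R x i j + w x i * w x j) k
          + coeff (fun x => u x i * w x j + w x i * u x j) k := fun i j k =>
        coeff_add (cww i j) (cuw i j) k
      refine hS X (fun i j k => ?_) fun i j k hk hk0 => ?_
      · rw [hcX]
        refine (norm_add_le _ _).trans (add_le_add (bww i j k) ((buw i j k).trans ?_))
        nlinarith
      · rw [hcX]
        refine (norm_add_le _ _).trans ((add_le_add (hlow i j k hk hk0) (buw i j k)).trans ?_)
        linarith
    have hY : hsq Y ≤ ENNReal.ofReal (δ / 4) := by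
      refine (hsq_symmGrad_le hw hsh h1).trans (ENNReal.ofReal_le_ofReal ?_)
      have : ε ^ 2 ≤ (Real.sqrt δ / 300) ^ 2 := by gcongr
      rw [div_pow, Real.sq_sqrt hδ.le] at this
      linarith
    have cX : ∀ i j, Continuous fun x => X x i j := fun i j => (cww i j).add (cuw i j)
    have cY : ∀ i j, Continuous fun x => Y x i j := fun i j =>
      (((hw j).pd i).add ((hw i).pd j)).continuous
    have hZ : hsq (removeMean (stressSum u w R)) ≤ 2 * (hsq X + hsq Y) := by
      have cZ : ∀ i j, Continuous fun x => stressSum u w R x i j :=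
        fun i j => (cX i j).sub (cY i j)
      refine hsq_le_of_coeff_le fun i j k hk => ?_
      rw [coeff_removeMean cZ i j hk]
      refine le_of_eq_of_le (congrArg norm ?_) (norm_sub_le _ _)
      exact coeff_sub (cX i j) (cY i j) k
    refine hZ.trans ((mul_le_mul_right (add_le_add hX hY) 2).trans (le_of_eq ?_))
    rw [← ENNReal.ofReal_add (by positivity) (by positivity), ← ENNReal.ofReal_ofNat,
      ← ENNReal.ofReal_mul (by norm_num)]
    congr 1; ring

/-! ### Propagation of the inductive conditions -/

theorem incr_update_of_le (u : ℕ → VField) (v : VField) {q m : ℕ} (hm : m ≤ q) :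
    incr (Function.update u (q + 1) v) m = incr u m := by
  cases m with
  | zero => simp [incr]
  | succ m =>
    simp only [incr]
    rw [Function.update_of_ne (show m + 1 ≠ q + 1 by omega),
      Function.update_of_ne (show m ≠ q + 1 by omega)]

theorem incr_update_succ (u : ℕ → VField) (w : VField) (q : ℕ) :
    incr (Function.update u (q + 1) (u q + w)) (q + 1) = w := by
  simp only [incr]
  rw [Function.update_self, Function.update_of_ne (show q ≠ q + 1 by omega), add_sub_cancel_left]

theorem one_lt_pexp (q : ℕ) : 1 < pexp q := by
  have : (2 : ℝ) ^ (-(q : ℤ) - 10) < 2 ^ (0 : ℤ) := zpow_lt_zpow_right₀ one_lt_two (by omega)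
  rw [pexp]; rw [zpow_zero] at this; linarith

theorem pexp_lt_two (q : ℕ) : pexp q < 2 := by
  have : (0 : ℝ) < 2 ^ (-(q : ℤ) - 10) := by positivity
  rw [pexp]; linarith

theorem pexp_le_succ (q : ℕ) : pexp q ≤ pexp (q + 1) := by
  have : (2 : ℝ) ^ (-((q + 1 : ℕ) : ℤ) - 10) ≤ 2 ^ (-(q : ℤ) - 10) :=
    zpow_le_zpow_right₀ one_le_two (by omega)
  rw [pexp, pexp]; linarith

theorem LpNorm_mono_exponent {p r : ℝ} (h : p ≤ r) {u : VField} (hu : Continuous u) :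
    LpNorm p u ≤ LpNorm r u :=
  eLpNorm_le_eLpNorm_of_exponent_le (ENNReal.ofReal_le_ofReal h) hu.aestronglyMeasurable

/-- Adding an increment small in `Lʳ` lowers the norm of the velocity by at most that much. -/
theorem lt_LpNorm_add {p r a b : ℝ} (hp : 1 ≤ p) (hpr : p ≤ r) (ha : 0 ≤ a) (hb : 0 ≤ b)
    {u w : VField} (hu : Continuous u) (hw : Continuous w)
    (h : ENNReal.ofReal (a + b) < LpNorm p u) (hwb : LpNorm r w ≤ ENNReal.ofReal b) :
    ENNReal.ofReal a < LpNorm r (u + w) := by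
  have h1 : LpNorm r u ≤ LpNorm r (u + w) + LpNorm r w := by
    have h2 := eLpNorm_sub_le (p := ENNReal.ofReal r) (hu.add hw).aestronglyMeasurable
      (μ := μT) hw.aestronglyMeasurable (by
        rw [← ENNReal.ofReal_one]; exact ENNReal.ofReal_le_ofReal (hp.trans hpr))
    rw [add_sub_cancel_right] at h2
    exact h2
  by_contra! hcon
  refine absurd h (not_lt.mpr ?_)
  rw [ENNReal.ofReal_add ha hb]
  exact (LpNorm_mono_exponent hpr hu).trans (h1.trans (add_le_add hcon hwb))

theorem sum_offDiag_range_succ_le (f : ℕ × ℕ → ℝ≥0∞) (n : ℕ) :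
    ∑ p ∈ (range (n + 1)).offDiag, f p
      ≤ ∑ p ∈ (range n).offDiag, f p + ∑ m ∈ range n, (f (n, m) + f (m, n)) := by
  have hu : ∀ s t : Finset (ℕ × ℕ), ∑ p ∈ s ∪ t, f p ≤ ∑ p ∈ s, f p + ∑ p ∈ t, f p :=
    fun s t => by rw [← sum_union_inter]; exact le_self_add
  rw [range_add_one, offDiag_insert notMem_range_self, sum_add_distrib]
  refine (hu _ _).trans ?_
  refine (add_le_add_left (hu _ _) _).trans (le_of_eq ?_)
  rw [sum_product, sum_product, sum_singleton, add_assoc]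
  simp

theorem exists_uniform_bound {u : ℕ → VField} {q : ℕ} (h : ∀ m ≤ q, SmoothV (u m)) :
    ∃ M : ℝ, 0 ≤ M ∧ ∀ m ≤ q, ∀ x i, |u m x i| ≤ M := by
  have h1 : ∀ m i, ∃ M : ℝ, 0 ≤ M ∧ (m ≤ q → ∀ x, |u m x i| ≤ M) := fun m i => by
    by_cases hm : m ≤ q
    · obtain ⟨M, hM⟩ := exists_bound_of_continuous (h m hm i).continuous
      exact ⟨M, (abs_nonneg _).trans (hM 0), fun _ => hM⟩
    · exact ⟨0, le_rfl, fun h => absurd h hm⟩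
  choose M hM0 hM using h1
  have h0 : ∀ m, 0 ≤ ∑ i, M m i := fun m => sum_nonneg fun i _ => hM0 m i
  refine ⟨∑ m ∈ range (q + 1), ∑ i, M m i, sum_nonneg fun m _ => h0 m, fun m hm x i => ?_⟩
  exact (hM m i hm x).trans ((single_le_sum (fun i _ => hM0 m i) (mem_univ i)).trans
    (single_le_sum (f := fun m => ∑ i, M m i) (fun m _ => h0 m) (mem_range.mpr (by omega))))

end StationaryNS
end

open StationaryNS UnitAddTorus Finset in
theorem proposition3p1 (φ : StationaryNS.E2 → ℝ) (hφ : StationaryNS.IsLPBump φ)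
    (C : ℝ) (hC : 0 < C) (q : ℕ) (u : ℕ → StationaryNS.VField) (R : StationaryNS.MField)
    (h : StationaryNS.InductiveConditions φ C q u R) :
    ∃ (w : StationaryNS.VField) (R' : StationaryNS.MField),
      StationaryNS.SmoothV w ∧ StationaryNS.MeanZeroV w ∧
      StationaryNS.SmoothM R' ∧ StationaryNS.MeanZeroM R' ∧
      StationaryNS.InductiveConditions φ C (q + 1) (Function.update u (q + 1) (u q + w)) R' := by
  set t : ℝ := (2 : ℝ) ^ (-(q : ℤ)) with ht
  have ht0 : 0 < t := by positivity
  have two0 : (2 : ℝ) ≠ 0 := two_ne_zero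
  have et1 : (2 : ℝ) ^ (-((q + 1 : ℕ) : ℤ)) = t / 2 := by
    rw [show -((q + 1 : ℕ) : ℤ) = -(q : ℤ) - 1 by push_cast; ring, zpow_sub₀ two0]; simp [ht]
  have et2 : (2 : ℝ) ^ (-((q + 1 : ℕ) : ℤ) - 2) = t / 8 := by
    rw [zpow_sub₀ two0, et1]; norm_num; ring
  have et3 : (2 : ℝ) ^ (-((q + 1 : ℕ) : ℤ) - 10) = t / 2048 := by
    rw [zpow_sub₀ two0, et1]; norm_num; ring
  have et4 : (2 : ℝ) ^ (-(q : ℤ) - 10) = t / 1024 := by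
    rw [zpow_sub₀ two0, ← ht]; norm_num
  obtain ⟨jq, hjq, hdisj⟩ := h.shells
  have huc : ∀ i, Continuous fun x => u q x i := fun i => (h.smooth i).continuous
  have hRc : ∀ i j, Continuous fun x => R x i j := fun i j => (h.stress_smooth i j).continuous
  obtain ⟨M, hM0, hM⟩ := exists_uniform_bound h.incr_smooth
  -- otherwise the right-hand side of the strict inequality in `off_diagonal` would vanish
  have hpos : 0 < C - t := by
    by_contra! hcon
    have hlt := h.off_diagonal
    rw [ENNReal.ofReal_of_nonpos hcon] at hlt
    exact not_lt_zero hlt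
  have hbudget : ENNReal.ofReal (C - (2 : ℝ) ^ (-((q + 1 : ℕ) : ℤ)))
      = ENNReal.ofReal (C - t) + ENNReal.ofReal (t / 2) := by
    rw [← ENNReal.ofReal_add hpos.le (by positivity), et1]; congr 1; ring
  -- `B` depends on `R` only; the modes `S` to be controlled and the size `ε` are then chosen in
  -- terms of `B`, and `w` comes last
  obtain ⟨B, hB⟩ := exists_increment hRc h.solves.1
  obtain ⟨S, ε₁, hε₁, hS⟩ := exists_hsq_stress_le huc hRc B (δ := (t / 4096) ^ 2) (by positivity)
  obtain ⟨ε₂, hε₂, hLp⟩ := exists_LpNorm_lt B (one_lt_pexp (q + 1)) (pexp_lt_two (q + 1))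
    (η := min (t / 8) (C⁻¹ * (t / 2))) (by positivity)
  obtain ⟨ε, hε0, hε⟩ : ∃ ε > 0, ε ≤ min (min ε₁ ε₂) (t / 2 / ((q + 1) * (8 * (M + 1)))) :=
    ⟨_, by positivity, le_rfl⟩
  have hεε₁ : ε ≤ ε₁ := hε.trans ((min_le_left _ _).trans (min_le_left _ _))
  have hεε₂ : ε ≤ ε₂ := hε.trans ((min_le_left _ _).trans (min_le_right _ _))
  have hεM : (q + 1) * (8 * (M * ε)) ≤ t / 2 := by
    have h1 := hε.trans (min_le_right _ _)
    rw [le_div_iff₀ (by positivity)] at h1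
    refine le_trans ?_ h1
    have : 0 ≤ (q + 1 : ℝ) * (8 * ε) := by positivity
    linarith
  obtain ⟨w, hw, hdiv, ⟨j, hj, hsh⟩, hw1, hw2, hlow⟩ :=
    hB ε hε0 S (∑ m ∈ range (q + 1), jq m + 2)
  obtain ⟨hquad, hstress⟩ := hS ε hεε₁ w j hw hsh hw1 hw2 hlow
  have hwc : ∀ i, Continuous fun x => w x i := fun i => (hw i).continuous
  have hws : SmoothV w := fun i => (hw i).smooth
  have hwLp := hLp w hwc (fun i => (hw1 i).trans hεε₂) hw2
  have hmean : MeanZeroV w := fun i => by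
    have h0 : coeff (fun x => w x i) 0 = 0 := by
      by_contra h0
      have h1 := (hsh i 0 h0).1
      rw [show freq 0 = 0 by ext i; simp [freq], norm_zero] at h1
      have : (0 : ℝ) < 2 ^ j := by positivity
      linarith
    rw [coeff_zero] at h0
    exact Complex.ofReal_eq_zero.mp h0
  have hRs := smoothM_stressSum h.smooth hws h.stress_smooth
  have hcomp : ∀ {v : VField}, SmoothV v → Continuous v := fun hv =>
    continuous_of_components fun i => (hv i).continuous
  have hjlt : ∀ m ≤ q, jq m + 2 ≤ j := fun m hm => by
    have := single_le_sum (f := jq) (fun _ _ => Nat.zero_le _)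
      (mem_range.mpr (show m < q + 1 by omega))
    omega
  have hincr : ∀ m ≤ q, incr (Function.update u (q + 1) (u q + w)) m = incr u m :=
    fun m hm => incr_update_of_le u _ hm
  have hincr' := incr_update_succ u w q
  have hlast : Function.update u (q + 1) (u q + w) (q + 1) = u q + w := Function.update_self ..
  refine ⟨w, removeMean (stressSum (u q) w R), hws, hmean, smoothM_removeMean hRs,
    meanZeroM_removeMean fun i j => (hRs i j).continuous, ?_⟩
  constructor
  · rw [hlast]
    exact h.solves.add_increment h.smooth h.stress_smooth hw hdiv
  · rw [hlast]
    intro i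
    refine (integral_add (integrable_of_continuous (huc i))
      (integrable_of_continuous (hwc i))).trans ?_
    rw [h.mean_zero i, hmean i, add_zero]
  · rw [hlast]
    exact fun i => (h.smooth i).add (hws i)
  · rw [hlast, et1]
    refine lt_LpNorm_add (b := C⁻¹ * (t / 2)) (one_lt_pexp q).le (pexp_le_succ q) (by positivity)
      (by positivity) (hcomp h.smooth) (hcomp hws) ?_
      (hwLp.le.trans (ENNReal.ofReal_le_ofReal (min_le_right _ _)))
    convert h.lower_bound using 2
    ring
  · intro m hm
    rcases Nat.le_or_eq_of_le_succ hm with hm | rfl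
    · rw [hincr m hm]
      exact h.incr_bound m hm
    · rw [hincr', et2]
      exact hwLp.trans_le (ENNReal.ofReal_le_ofReal (min_le_left _ _))
  · intro m hm
    rcases Nat.le_or_eq_of_le_succ hm with hm | rfl
    · rw [hincr m hm]
      exact h.incr_smooth m hm
    · rw [hincr']
      exact hws
  · exact smoothM_removeMean hRs
  · rw [et3, HNormM_lt_iff _ (by positivity)]
    refine hstress.trans_lt ((ENNReal.ofReal_lt_ofReal_iff (by positivity)).mpr ?_)
    gcongr
    norm_num
  · refine ⟨Function.update jq (q + 1) j, fun m hm => ?_, fun m n hmn hn => ?_⟩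
    · rcases Nat.le_or_eq_of_le_succ hm with hm | rfl
      · rw [hincr m hm, Function.update_of_ne (by omega)]
        exact hjq m hm
      · rw [hincr', Function.update_self]
        exact fun x i => (hw i).shellProj_eq (fun k hk => (hsh i k hk).dil_eq_one hφ) x
    · rw [Function.update_of_ne (show m ≠ q + 1 by omega)]
      rcases Nat.le_or_eq_of_le_succ hn with hn | rfl
      · rw [Function.update_of_ne (show n ≠ q + 1 by omega)]
        exact hdisj m n hmn hn
      · rw [Function.update_self]
        exact hφ.disjoint _ _ (hjlt m (by omega))
  · have hold := h.off_diagonal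
    have hnew : ∑ m ∈ range (q + 1),
        (L1NormM (outer w (incr u m)) + L1NormM (outer (incr u m) w)) ≤ ENNReal.ofReal (t / 2) := by
      calc _ ≤ ∑ _m ∈ range (q + 1), ENNReal.ofReal (8 * (M * ε)) := by
            refine sum_le_sum fun m hm => ?_
            rw [L1NormM_outer_comm]
            refine (add_le_add
              (L1NormM_outer_le hwc (hM m (by rw [mem_range] at hm; omega)) hw1)
              (L1NormM_outer_le hwc (hM m (by rw [mem_range] at hm; omega)) hw1)).trans
              (le_of_eq ?_)
            rw [← ENNReal.ofReal_add (by positivity) (by positivity)]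
            congr 1; ring
        _ = ENNReal.ofReal ((q + 1) * (8 * (M * ε))) := by
            rw [sum_const, card_range, nsmul_eq_mul, ← ENNReal.ofReal_natCast,
              ← ENNReal.ofReal_mul (by positivity), Nat.cast_add_one]
        _ ≤ _ := ENNReal.ofReal_le_ofReal hεM
    rw [hbudget]
    refine lt_of_le_of_lt ?_ (ENNReal.add_lt_add_right ENNReal.ofReal_ne_top hold)
    refine (sum_offDiag_range_succ_le _ (q + 1)).trans
      (add_le_add (le_of_eq ?_) (le_of_eq_of_le ?_ hnew))
    · refine sum_congr rfl fun p hp => ?_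
      rw [mem_offDiag, mem_range, mem_range] at hp
      rw [hincr p.1 (by omega), hincr p.2 (by omega)]
    · refine sum_congr rfl fun m hm => ?_
      rw [mem_range] at hm
      rw [hincr', hincr m (by omega)]
  · have hold := h.diagonal
    -- `w ⊗ w` is the difference of the small field `R + w ⊗ w` and of `R`
    have hnew : HNormM (-2) (removeMean (outer w w)) < ENNReal.ofReal (t / 2) := by
      rw [HNormM_lt_iff _ (by positivity)]
      have hR2 := (HNormM_lt_iff R (by positivity)).mp h.stress_bound
      rw [et4] at hR2
      have cww : ∀ i j, Continuous fun x => outer w w x i j := fun i j => (hwc i).mul (hwc j)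
      have h1 : hsq (removeMean (outer w w)) ≤ 2 * (hsq
          (fun x => Matrix.of fun i j => R x i j + w x i * w x j) + hsq R) := by
        refine hsq_le_of_coeff_le fun i j k hk => ?_
        rw [coeff_removeMean cww i j hk]
        refine le_of_eq_of_le (congrArg norm ?_) (norm_sub_le _ _)
        have := coeff_add (hRc i j) (cww i j) k
        exact (sub_eq_of_eq_add' this).symm
      refine h1.trans_lt (lt_of_le_of_lt (mul_le_mul_right (add_le_add hquad hR2.le) 2) ?_)
      rw [← ENNReal.ofReal_add (by positivity) (by positivity), ← ENNReal.ofReal_ofNat,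
        ← ENNReal.ofReal_mul (by norm_num), ENNReal.ofReal_lt_ofReal_iff (by positivity)]
      nlinarith [sq_pos_of_pos ht0]
    rw [hbudget, sum_range_succ, hincr']
    refine ENNReal.add_lt_add (lt_of_eq_of_lt (sum_congr rfl fun m hm => ?_) hold) hnew
    rw [mem_range] at hm
    rw [hincr m (by omega)]
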